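/- Let $\nu(m)$ denote the exponent of $2$ in $m\ge 1$, $\sigma(m)$ the sum of the base two digits of $m\ge 0$, $[m]$ the set of powers of $2$ occurring in the base two representation of $m$, and $S(n,k)$ the Stirling number of the second kind. For $1\le k\le n$ the inequality $$\nu(S(n,k))\ \ge\ \sigma(k-1)-\sigma(n-1)+\#\bigl([n-1]\cap[n-k]\bigr)$$ is called the shifted almost minimum zero estimate. Let $h,k,u,c\ge 0$ be integers with $1\le k\le 2^h$ and $1\le u\le 2^{\nu(k)}$, and put $n=c2^h+u$. (1) If $c\ge 1$ and $u<k$, then $S(n,k)\neq 0$, the right-hand side of the shifted almost minimum zero estimate equals $\nu(k)+\sigma(k)-\nu(u)-2$, and the estimate holds, i.e. $$\nu\bigl(S(c2^h+u,k)\bigr)\ \ge\ \nu(k)+\sigma(k)-\nu(u)-2 .$$ Equality holds if and only if $u=1$, or $u$ is even with $u\le 2^{\nu(k)-1}$, or $u=1+2^{\nu(k)-1}$, or $u=2^{\nu(k)}$. (2) If $u=k$, then $\sigma(k)=1$ and $S(c2^h+u,k)$ is odd, i.e. $\nu(S(c2^h+u,k))=0$. -/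

import Mathlib

/-- The base two digit sum `σ(n)`. -/
def sigmaTwo (n : ℕ) : ℕ := (Nat.digits 2 n).sum

/-- The set `[n]` of the powers of two occurring in the base two representation of `n`. -/
def twoPowers (n : ℕ) : Finset ℕ := n.bitIndices.toFinset.image (fun i => 2 ^ i)

/-- The value `σ(k-1) - σ(n-1) + #([n-1] ∩ [n-k])` of the shifted almost minimum zero estimate
for `ν₂(S(n,k))`; it is used for `1 ≤ k ≤ n` only, so that no subtraction truncates. -/
def shiftedAlmostMinZeroEstimate (n k : ℕ) : ℤ :=
  (sigmaTwo (k - 1) : ℤ) - (sigmaTwo (n - 1) : ℤ)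
    + ((twoPowers (n - 1) ∩ twoPowers (n - k)).card : ℤ)

/-! Put `a = ν(k)`, `n = c * 2 ^ h + u`, and split `(-1) ^ k * k! * S(n,k) = E_n - O_n` according to
the parity of `j` in the alternating sum over `C(k,j) * j ^ n`. Let `u < k` and `c ≥ 1`. Modulo `2 ^
(k + a - 1 - ν(u))` the even part `E_n` vanishes, and `O_n` agrees with `O_u`
(`dvdTwoPow_sum_odd_sub`). Since `S(u,k) = 0`, the sums `E_u` and `O_u` coincide, so `O_u` is half
of the full sum over `C(k,j) * j ^ u`, that is `2 ^ (k - 1)` times the `u`-th moment of the binomial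
distribution with parameters `k` and `1 / 2`. As `ν(k!) = k - σ(k)`, everything reduces to the claim
that this moment has valuation at least `a - 1 - ν(u)`, with equality exactly for the listed `u`
(`binomialMoment_valuation`); the modulus is just one power of two finer than this bound.

For the congruence of the odd parts, `(1 + 2 * i) ^ M` is expanded in powers of `2 * i`, and these
in binomial coefficients `C(i,d)`. Each term is a product of `2 ^ r * d! * S(r,d) / r!`, of `r!`
times a difference of binomial coefficients, and of a sum over even indices with a closed form. The
three valuations add up to enough because of an inequality about binary carries (`carry_bound`).

For the moments, the logarithmic derivative of `(1 + e ^ X) ^ k` is `k` times the logistic function,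
whose Taylor coefficients are essentially Genocchi numbers, hence of known valuation
(`exactTwoPow_genocchi`). In the resulting recursion at most two terms have the least valuation: the
one with moment zero and the one with moment `2 ^ (a - 1)`. If both do, they cancel modulo the next
power of two.

If `u = k`, then `k` is a power of two, and modulo 2 the numbers `S(n,k)` with `k` even are binomial
coefficients (`stirlingSecond_modEq_choose`). -/

/-! ### Binary digit sums, with the formulas of Legendre and Kummer. -/

theorem sigmaTwo_zero : sigmaTwo 0 = 0 := by simp [sigmaTwo]

theorem sigmaTwo_two_mul (n : ℕ) : sigmaTwo (2 * n) = sigmaTwo n := by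
  rcases Nat.eq_zero_or_pos n with rfl | hn
  · rfl
  · unfold sigmaTwo
    rw [Nat.digits_def' (by norm_num) (by omega)]
    simp

theorem sigmaTwo_two_mul_add_one (n : ℕ) : sigmaTwo (2 * n + 1) = sigmaTwo n + 1 := by
  unfold sigmaTwo
  rw [Nat.digits_def' (by norm_num) (by omega)]
  have h1 : (2 * n + 1) % 2 = 1 := by omega
  have h2 : (2 * n + 1) / 2 = n := by omega
  rw [h1, h2, List.sum_cons, add_comm]

theorem sigmaTwo_bit (n b : ℕ) (hb : b ≤ 1) : sigmaTwo (2 * n + b) = sigmaTwo n + b := by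
  interval_cases b
  · exact sigmaTwo_two_mul n
  · exact sigmaTwo_two_mul_add_one n

theorem sigmaTwo_one : sigmaTwo 1 = 1 := by simp [sigmaTwo]

theorem padicValNat_factorial_add_sigmaTwo (n : ℕ) :
    padicValNat 2 n.factorial + sigmaTwo n = n := by
  have h := sub_one_mul_padicValNat_factorial (p := 2) n
  have h2 := Nat.digit_sum_le 2 n
  unfold sigmaTwo
  omega

/-- Kummer's formula, from Legendre's for the three factorials. -/
theorem padicValNat_choose_add_sigmaTwo {n k : ℕ} (h : k ≤ n) :
    padicValNat 2 (n.choose k) + sigmaTwo n = sigmaTwo k + sigmaTwo (n - k) := by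
  have e := congrArg (padicValNat 2) (Nat.choose_mul_factorial_mul_factorial h)
  rw [padicValNat.mul (mul_ne_zero (Nat.choose_pos h).ne' k.factorial_ne_zero)
      (n - k).factorial_ne_zero,
    padicValNat.mul (Nat.choose_pos h).ne' k.factorial_ne_zero] at e
  have h1 := padicValNat_factorial_add_sigmaTwo n
  have h2 := padicValNat_factorial_add_sigmaTwo k
  have h3 := padicValNat_factorial_add_sigmaTwo (n - k)
  omega

theorem sigmaTwo_add_le (m n : ℕ) : sigmaTwo (m + n) ≤ sigmaTwo m + sigmaTwo n := by
  have h := padicValNat_choose_add_sigmaTwo (Nat.le_add_right m n)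
  rw [Nat.add_sub_cancel_left] at h
  omega

theorem sigmaTwo_le (n : ℕ) : sigmaTwo n ≤ n := by
  have := padicValNat_factorial_add_sigmaTwo n
  omega

theorem sigmaTwo_succ_add_padicValNat (n : ℕ) :
    sigmaTwo (n + 1) + padicValNat 2 (n + 1) = sigmaTwo n + 1 := by
  have h1 := padicValNat_factorial_add_sigmaTwo n
  have h2 := padicValNat_factorial_add_sigmaTwo (n + 1)
  rw [Nat.factorial_succ, padicValNat.mul (by omega) n.factorial_ne_zero] at h2
  omega

theorem sigmaTwo_pow_mul_add (h c r : ℕ) (hr : r < 2 ^ h) :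
    sigmaTwo (c * 2 ^ h + r) = sigmaTwo c + sigmaTwo r := by
  induction h generalizing r with
  | zero =>
    have : r = 0 := by simpa using hr
    simp [this, sigmaTwo_zero]
  | succ h ih =>
    have e : c * 2 ^ (h + 1) + r = 2 * (c * 2 ^ h + r / 2) + r % 2 := by
      have := Nat.div_add_mod r 2
      rw [pow_succ]; linarith
    have e2 : sigmaTwo r = sigmaTwo (r / 2) + r % 2 := by
      conv_lhs => rw [← Nat.div_add_mod r 2]
      exact sigmaTwo_bit _ _ (by omega)
    rw [e, sigmaTwo_bit _ _ (by omega), ih _ (by rw [pow_succ] at hr; omega), e2]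
    omega

theorem sigmaTwo_compl (h z : ℕ) (hz : z < 2 ^ h) :
    sigmaTwo (2 ^ h - 1 - z) + sigmaTwo z = h := by
  induction h generalizing z with
  | zero =>
    have : z = 0 := by simpa using hz
    simp [this, sigmaTwo_zero]
  | succ h ih =>
    have hz2 : z / 2 < 2 ^ h := by rw [pow_succ] at hz; omega
    have e2 : sigmaTwo z = sigmaTwo (z / 2) + z % 2 := by
      conv_lhs => rw [← Nat.div_add_mod z 2]
      exact sigmaTwo_bit _ _ (by omega)
    have e : 2 ^ (h + 1) - 1 - z = 2 * (2 ^ h - 1 - z / 2) + (1 - z % 2) := by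
      rw [pow_succ]; omega
    have := ih _ hz2
    rw [e, sigmaTwo_bit _ _ (by omega), e2]
    omega

theorem sigmaTwo_le_of_lt (h z : ℕ) (hz : z < 2 ^ h) : sigmaTwo z ≤ h := by
  have := sigmaTwo_compl h z hz
  omega

theorem sigmaTwo_two_pow (h : ℕ) : sigmaTwo (2 ^ h) = 1 := by
  have := sigmaTwo_pow_mul_add h 1 0 (by positivity)
  simpa [sigmaTwo_zero, sigmaTwo_one] using this

theorem sigmaTwo_le_of_le (h z : ℕ) (hh : 1 ≤ h) (hz : z ≤ 2 ^ h) : sigmaTwo z ≤ h := by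
  rcases hz.lt_or_eq with h1 | rfl
  · exact sigmaTwo_le_of_lt h z h1
  · rw [sigmaTwo_two_pow]; exact hh

theorem sigmaTwo_pos (z : ℕ) (hz : 1 ≤ z) : 1 ≤ sigmaTwo z := by
  induction z using Nat.strong_induction_on with
  | _ z ih =>
    have e2 : sigmaTwo z = sigmaTwo (z / 2) + z % 2 := by
      conv_lhs => rw [← Nat.div_add_mod z 2]
      exact sigmaTwo_bit _ _ (by omega)
    rcases Nat.mod_two_eq_zero_or_one z with h0 | h0
    · have := ih (z / 2) (by omega) (by omega)
      omega
    · omega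

/-- Strictly below `2 ^ h - 1` not all binary digits are one. -/
theorem sigmaTwo_lt_of_succ_lt (h z : ℕ) (hz : z + 1 < 2 ^ h) : sigmaTwo z + 1 ≤ h := by
  have h1 := sigmaTwo_compl h z (by omega)
  have h2 := sigmaTwo_pos (2 ^ h - 1 - z) (by omega)
  omega

/-! ### Inequalities about binary carries. -/

/-- The case `a = 0` of `carry_bound`, where `v + δ` is a single bit `w`. Induction on the number of
digits: `w`, `ε`, `γ` are the carries entering the lowest digit of the three nested additions, and
one digit step is a finite check. -/
theorem carry_bound_aux (H x κ w ε γ : ℕ) (hw : w ≤ 1) (hε : ε ≤ 1) (hγ : γ ≤ 1)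
    (hs : (x + w) + (κ + (x + w) + ε) + γ < 2 ^ H) :
    sigmaTwo x + sigmaTwo ((x + w) + (κ + (x + w) + ε) + γ) + (2 * w + (1 - w) * ε)
      ≤ H + sigmaTwo (x + w) + sigmaTwo (κ + (x + w) + ε) + w * γ := by
  induction H generalizing x κ w ε γ with
  | zero =>
    have hs' : (x + w) + (κ + (x + w) + ε) + γ < 1 := by simpa using hs
    have h1 : x = 0 := by omega
    have h2 : κ = 0 := by omega
    have h3 : w = 0 := by omega
    have h4 : ε = 0 := by omega
    have h5 : γ = 0 := by omega
    subst h1 h2 h3 h4 h5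
    simp [sigmaTwo_zero]
  | succ H ih =>
    obtain ⟨x', x0, hx0, rfl⟩ : ∃ x' x0, x0 ≤ 1 ∧ x = 2 * x' + x0 :=
      ⟨x / 2, x % 2, by omega, by omega⟩
    obtain ⟨κ', k0, hk0, rfl⟩ : ∃ x' x0, x0 ≤ 1 ∧ κ = 2 * x' + x0 :=
      ⟨κ / 2, κ % 2, by omega, by omega⟩
    rw [pow_succ] at hs
    have key : ∀ w' d0 ε' y0 γ' s0 : ℕ, w' ≤ 1 → ε' ≤ 1 → γ' ≤ 1 → d0 ≤ 1 → y0 ≤ 1 → s0 ≤ 1 →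
        x0 + w = 2 * w' + d0 → k0 + d0 + ε = 2 * ε' + y0 → d0 + y0 + γ = 2 * γ' + s0 →
        x0 + s0 + (2 * w + (1 - w) * ε) + w' * γ' ≤
          1 + d0 + y0 + w * γ + (2 * w' + (1 - w') * ε') →
        sigmaTwo (2 * x' + x0) + sigmaTwo ((2 * x' + x0 + w) +
          (2 * κ' + k0 + (2 * x' + x0 + w) + ε) + γ) + (2 * w + (1 - w) * ε)
        ≤ H + 1 + sigmaTwo (2 * x' + x0 + w) +
          sigmaTwo (2 * κ' + k0 + (2 * x' + x0 + w) + ε) + w * γ := by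
      intro w' d0 ε' y0 γ' s0 h1 h2 h3 h4 h5 h6 e1 e2 e3 hle
      have i := ih x' κ' w' ε' γ' h1 h2 h3 (by omega)
      have d1 : 2 * x' + x0 + w = 2 * (x' + w') + d0 := by omega
      have d2 : 2 * κ' + k0 + (2 * x' + x0 + w) + ε = 2 * (κ' + (x' + w') + ε') + y0 := by omega
      have d3 : (2 * x' + x0 + w) + (2 * κ' + k0 + (2 * x' + x0 + w) + ε) + γ
          = 2 * ((x' + w') + (κ' + (x' + w') + ε') + γ') + s0 := by omega
      rw [d3, d2, d1, sigmaTwo_bit _ _ hx0, sigmaTwo_bit _ _ h4, sigmaTwo_bit _ _ h5,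
        sigmaTwo_bit _ _ h6]
      omega
    refine key ((x0 + w) / 2) ((x0 + w) % 2) ((k0 + (x0 + w) % 2 + ε) / 2)
      ((k0 + (x0 + w) % 2 + ε) % 2)
      (((x0 + w) % 2 + (k0 + (x0 + w) % 2 + ε) % 2 + γ) / 2)
      (((x0 + w) % 2 + (k0 + (x0 + w) % 2 + ε) % 2 + γ) % 2)
      (by omega) (by omega) (by omega) (by omega) (by omega) (by omega) (by omega) (by omega)
      (by omega) ?_
    interval_cases x0 <;> interval_cases k0 <;> interval_cases w <;> interval_cases ε <;>
      interval_cases γ <;> simp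

/-- Used with `δ = γ = 0` and `ε = 1`; the general carries make the digitwise induction close. The
condition `hst` survives a step because `2 ^ a * κ` has digit zero there: `ε = 1` is passed on only
through a digit one of `x + v`, and then the other two additions produce no carry. -/
theorem carry_bound (a H x v κ δ ε γ : ℕ) (hv : v + δ ≤ 2 ^ a) (hδ : δ ≤ 1) (hε : ε ≤ 1)
    (hγ : γ ≤ 1) (hst : ε = 0 ∨ (δ = 0 ∧ γ = 0))
    (hs : (x + v + δ) + (2 ^ a * κ + (x + v + δ) + ε) + γ < 2 ^ H) :
    sigmaTwo x + sigmaTwo v + sigmaTwo ((x + v + δ) + (2 ^ a * κ + (x + v + δ) + ε) + γ)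
        + 2 * δ + ε
      ≤ H + sigmaTwo (x + v + δ) + sigmaTwo (2 ^ a * κ + (x + v + δ) + ε) + δ * γ := by
  induction a generalizing H x v κ δ ε γ with
  | zero =>
    have hv' : v + δ ≤ 1 := by simpa using hv
    have hvs : sigmaTwo v = v := by
      have : v ≤ 1 := by omega
      interval_cases v
      · exact sigmaTwo_zero
      · exact sigmaTwo_one
    rw [pow_zero, one_mul, add_assoc x v δ] at hs ⊢
    have h := carry_bound_aux H x κ (v + δ) ε γ hv' hε hγ hs
    rw [hvs]
    have hv1 : v ≤ 1 := by omega
    interval_cases v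
    · interval_cases δ <;> simp at h ⊢ <;> omega
    · have : δ = 0 := by omega
      subst this
      simp at h ⊢
      omega
  | succ a ih =>
    rcases H with _ | H
    · have hs' : (x + v + δ) + (2 ^ (a + 1) * κ + (x + v + δ) + ε) + γ < 1 := by simpa using hs
      have h1 : x = 0 := by omega
      have h2 : 2 ^ (a + 1) * κ = 0 := by omega
      have h3 : v = 0 := by omega
      have h4 : ε = 0 := by omega
      have h5 : γ = 0 := by omega
      have h6 : δ = 0 := by omega
      rw [h2]
      subst h1 h3 h4 h5 h6
      simp [sigmaTwo_zero]
    obtain ⟨x', x0, hx0, rfl⟩ : ∃ x' x0, x0 ≤ 1 ∧ x = 2 * x' + x0 :=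
      ⟨x / 2, x % 2, by omega, by omega⟩
    obtain ⟨v', v0, hv0, rfl⟩ : ∃ x' x0, x0 ≤ 1 ∧ v = 2 * x' + x0 :=
      ⟨v / 2, v % 2, by omega, by omega⟩
    have hκ : 2 ^ (a + 1) * κ = 2 * (2 ^ a * κ) := by ring
    rw [hκ] at hs ⊢
    rw [pow_succ] at hs hv
    set K := 2 ^ a * κ with hK
    have key : ∀ w' d0 ε' y0 γ' s0 : ℕ, w' ≤ 1 → ε' ≤ 1 → γ' ≤ 1 → d0 ≤ 1 → y0 ≤ 1 → s0 ≤ 1 →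
        x0 + v0 + δ = 2 * w' + d0 → d0 + ε = 2 * ε' + y0 → d0 + y0 + γ = 2 * γ' + s0 →
        x0 + v0 + s0 + 2 * δ + ε + w' * γ' ≤ 1 + d0 + y0 + δ * γ + 2 * w' + ε' →
        (ε' = 0 ∨ (w' = 0 ∧ γ' = 0)) →
        sigmaTwo (2 * x' + x0) + sigmaTwo (2 * v' + v0) +
          sigmaTwo ((2 * x' + x0 + (2 * v' + v0) + δ) +
          (2 * K + (2 * x' + x0 + (2 * v' + v0) + δ) + ε) + γ) + 2 * δ + ε
        ≤ H + 1 + sigmaTwo (2 * x' + x0 + (2 * v' + v0) + δ) +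
          sigmaTwo (2 * K + (2 * x' + x0 + (2 * v' + v0) + δ) + ε) + δ * γ := by
      intro w' d0 ε' y0 γ' s0 h1 h2 h3 h4 h5 h6 e1 e2 e3 hle hst'
      have i := ih H x' v' κ w' ε' γ' (by omega) h1 h2 h3 hst' (by omega)
      rw [← hK] at i
      have d1 : 2 * x' + x0 + (2 * v' + v0) + δ = 2 * (x' + v' + w') + d0 := by omega
      have d2 : 2 * K + (2 * x' + x0 + (2 * v' + v0) + δ) + ε
          = 2 * (K + (x' + v' + w') + ε') + y0 := by omega
      have d3 : (2 * x' + x0 + (2 * v' + v0) + δ) +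
          (2 * K + (2 * x' + x0 + (2 * v' + v0) + δ) + ε) + γ
          = 2 * ((x' + v' + w') + (K + (x' + v' + w') + ε') + γ') + s0 := by omega
      rw [d3, d2, d1, sigmaTwo_bit _ _ hx0, sigmaTwo_bit _ _ hv0, sigmaTwo_bit _ _ h4,
        sigmaTwo_bit _ _ h5, sigmaTwo_bit _ _ h6]
      omega
    have p1 : ((x0 + v0 + δ) % 2 + ε) / 2 = 0 ∨ ((x0 + v0 + δ) / 2 = 0 ∧
        ((x0 + v0 + δ) % 2 + ((x0 + v0 + δ) % 2 + ε) % 2 + γ) / 2 = 0) := by omega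
    refine key ((x0 + v0 + δ) / 2) ((x0 + v0 + δ) % 2) (((x0 + v0 + δ) % 2 + ε) / 2)
      (((x0 + v0 + δ) % 2 + ε) % 2)
      (((x0 + v0 + δ) % 2 + ((x0 + v0 + δ) % 2 + ε) % 2 + γ) / 2)
      (((x0 + v0 + δ) % 2 + ((x0 + v0 + δ) % 2 + ε) % 2 + γ) % 2)
      (by omega) (by omega) (by omega) (by omega) (by omega) (by omega) (by omega) (by omega)
      (by omega) ?_ p1
    interval_cases x0 <;> interval_cases v0 <;> interval_cases δ <;> interval_cases ε <;>
      interval_cases γ <;> simp at hst ⊢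

/-- Kummer's formula expresses the valuation by digit sums of `k - d - 2` and `k - 2 * d - 2` with
`d = x + v`. Complementing in `h` digits turns these into sums built from `d` and `2 ^ h - k`, a
multiple of `2 ^ a`, so that `carry_bound` applies. -/
theorem sigmaTwo_add_sigmaTwo_le_choose {h k a x v : ℕ} (hk : 2 ^ a ∣ k) (hkh : k ≤ 2 ^ h)
    (hah : a ≤ h) (hv : v ≤ 2 ^ a) (hd : 2 * (x + v) + 2 ≤ k) :
    sigmaTwo x + sigmaTwo v + 1
      ≤ h + padicValNat 2 ((k - (x + v) - 2).choose (x + v)) := by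
  obtain ⟨κ, hκ⟩ : 2 ^ a ∣ 2 ^ h - k := Nat.dvd_sub (pow_dvd_pow 2 hah) hk
  have h1 := carry_bound a h x v κ 0 1 0 (by omega) (by omega) (by omega) (by omega)
    (Or.inr ⟨rfl, rfl⟩) (by rw [← hκ]; omega)
  rw [← hκ] at h1
  simp only [add_zero, mul_zero] at h1
  have h2 := padicValNat_choose_add_sigmaTwo (show x + v ≤ k - (x + v) - 2 by omega)
  have h3 := sigmaTwo_compl h (k - (x + v) - 2) (by omega)
  have h4 := sigmaTwo_compl h (k - (x + v) - 2 - (x + v)) (by omega)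
  have e3 : 2 ^ h - 1 - (k - (x + v) - 2) = 2 ^ h - k + (x + v) + 1 := by omega
  have e4 : 2 ^ h - 1 - (k - (x + v) - 2 - (x + v))
      = x + v + (2 ^ h - k + (x + v) + 1) := by omega
  rw [e3] at h3
  rw [e4] at h4
  omega

/-- Lowering `x` by `x + v - d` costs at most that much in digit sum, which reduces to `d = x + v`;
if `d < v` trivial bounds suffice. -/
theorem sigmaTwo_add_sigmaTwo_le_choose_of_le {h k a x v d : ℕ} (hk : 2 ^ a ∣ k)
    (hkh : k ≤ 2 ^ h) (hah : a ≤ h) (h1h : 1 ≤ h) (hv : v ≤ 2 ^ a) (hdr : d ≤ x + v)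
    (hd : 2 * d + 2 ≤ k) :
    sigmaTwo x + sigmaTwo v + 1
      ≤ h + (x + v - d) + padicValNat 2 ((k - d - 2).choose d) := by
  rcases le_or_gt v d with hvd | hvd
  · have h1 := sigmaTwo_add_sigmaTwo_le_choose (x := d - v) hk hkh hah hv (by omega)
    rw [Nat.sub_add_cancel hvd] at h1
    have h2 := sigmaTwo_add_le (d - v) (x + v - d)
    have h3 := sigmaTwo_le (x + v - d)
    rw [show d - v + (x + v - d) = x by omega] at h2
    omega
  · have h2 := sigmaTwo_le x
    have h3 := sigmaTwo_le_of_le h v h1h (hv.trans (Nat.pow_le_pow_right (by norm_num) hah))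
    omega

theorem sigmaTwo_le_of_odd {h x d : ℕ} (hd : 1 ≤ d) (hdx : d ≤ x + 1) (hdk : 2 * d + 2 ≤ 2 ^ h) :
    sigmaTwo x + 2 ≤ h + (x + 1 - d) := by
  obtain ⟨h, rfl⟩ : ∃ h', h = h' + 1 := ⟨h - 1, by
    rcases h with _ | h
    · simp at hdk
    · omega⟩
  rw [pow_succ] at hdk
  have h1 := sigmaTwo_lt_of_succ_lt h (d - 1) (by omega)
  have h2 := sigmaTwo_add_le (d - 1) (x + 1 - d)
  have h3 := sigmaTwo_le (x + 1 - d)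
  rw [show d - 1 + (x + 1 - d) = x by omega] at h2
  omega

/-! ### Calculus of 2-adic valuations on the rationals. -/

open Finset PowerSeries

/-- The rational number `x` is zero or has `2`-adic valuation at least `m`. -/
def DvdTwoPow (m : ℤ) (x : ℚ) : Prop := ∃ p q : ℤ, Odd q ∧ x * q = 2 ^ m * p

/-- The rational number `x` is nonzero and has `2`-adic valuation `m`. -/
def ExactTwoPow (m : ℤ) (x : ℚ) : Prop := ∃ p q : ℤ, Odd p ∧ Odd q ∧ x * q = 2 ^ m * p

theorem ExactTwoPow.dvdTwoPow {m : ℤ} {x : ℚ} (h : ExactTwoPow m x) : DvdTwoPow m x := by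
  obtain ⟨p, q, _, hq, e⟩ := h
  exact ⟨p, q, hq, e⟩

theorem DvdTwoPow.zero (m : ℤ) : DvdTwoPow m 0 := ⟨0, 1, odd_one, by simp⟩

theorem Int.cast_ne_zero_of_odd {q : ℤ} (hq : Odd q) : (q : ℚ) ≠ 0 := by
  rintro h
  rw [Int.cast_eq_zero] at h
  subst h
  simp at hq

theorem DvdTwoPow.mono {m m' : ℤ} {x : ℚ} (h : DvdTwoPow m x) (hm : m' ≤ m) :
    DvdTwoPow m' x := by
  obtain ⟨p, q, hq, e⟩ := h
  obtain ⟨j, rfl⟩ := Int.le.dest hm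
  refine ⟨2 ^ j * p, q, hq, ?_⟩
  rw [e, zpow_add₀ (by norm_num), zpow_natCast]
  push_cast
  ring

theorem DvdTwoPow.mul {m m' : ℤ} {x y : ℚ} (hx : DvdTwoPow m x) (hy : DvdTwoPow m' y) :
    DvdTwoPow (m + m') (x * y) := by
  obtain ⟨p, q, hq, e⟩ := hx
  obtain ⟨p', q', hq', e'⟩ := hy
  refine ⟨p * p', q * q', hq.mul hq', ?_⟩
  rw [zpow_add₀ (by norm_num)]
  push_cast
  linear_combination y * q' * e + 2 ^ m * p * e'

theorem ExactTwoPow.mul {m m' : ℤ} {x y : ℚ} (hx : ExactTwoPow m x) (hy : ExactTwoPow m' y) :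
    ExactTwoPow (m + m') (x * y) := by
  obtain ⟨p, q, hp, hq, e⟩ := hx
  obtain ⟨p', q', hp', hq', e'⟩ := hy
  refine ⟨p * p', q * q', hp.mul hp', hq.mul hq', ?_⟩
  rw [zpow_add₀ (by norm_num)]
  push_cast
  linear_combination y * q' * e + 2 ^ m * p * e'

theorem ExactTwoPow.inv {m : ℤ} {x : ℚ} (hx : ExactTwoPow m x) : ExactTwoPow (-m) x⁻¹ := by
  obtain ⟨p, q, hp, hq, e⟩ := hx
  refine ⟨q, p, hq, hp, ?_⟩
  have h1 := Int.cast_ne_zero_of_odd hp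
  have h2 := Int.cast_ne_zero_of_odd hq
  have h3 : (2 : ℚ) ^ m ≠ 0 := zpow_ne_zero _ (by norm_num)
  have h4 : x ≠ 0 := by
    rintro rfl
    rw [zero_mul] at e
    exact mul_ne_zero h3 h1 e.symm
  rw [zpow_neg]
  field_simp
  linear_combination -e

theorem DvdTwoPow.add {m : ℤ} {x y : ℚ} (hx : DvdTwoPow m x) (hy : DvdTwoPow m y) :
    DvdTwoPow m (x + y) := by
  obtain ⟨p, q, hq, e⟩ := hx
  obtain ⟨p', q', hq', e'⟩ := hy
  refine ⟨p * q' + p' * q, q * q', hq.mul hq', ?_⟩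
  push_cast
  linear_combination q' * e + q * e'

theorem DvdTwoPow.neg {m : ℤ} {x : ℚ} (hx : DvdTwoPow m x) : DvdTwoPow m (-x) := by
  obtain ⟨p, q, hq, e⟩ := hx
  exact ⟨-p, q, hq, by push_cast; linear_combination -e⟩

theorem ExactTwoPow.neg {m : ℤ} {x : ℚ} (hx : ExactTwoPow m x) : ExactTwoPow m (-x) := by
  obtain ⟨p, q, hp, hq, e⟩ := hx
  exact ⟨-p, q, hp.neg, hq, by push_cast; linear_combination -e⟩

theorem DvdTwoPow.sub {m : ℤ} {x y : ℚ} (hx : DvdTwoPow m x) (hy : DvdTwoPow m y) :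
    DvdTwoPow m (x - y) := by
  rw [sub_eq_add_neg]
  exact hx.add hy.neg

theorem DvdTwoPow.sum {ι : Type*} {m : ℤ} (s : Finset ι) (f : ι → ℚ)
    (h : ∀ i ∈ s, DvdTwoPow m (f i)) : DvdTwoPow m (∑ i ∈ s, f i) := by
  classical
  induction s using Finset.induction_on with
  | empty => exact DvdTwoPow.zero m
  | insert a s ha ih =>
    rw [Finset.sum_insert ha]
    exact (h a (Finset.mem_insert_self a s)).add
      (ih fun i hi => h i (Finset.mem_insert_of_mem hi))

theorem ExactTwoPow.add {m : ℤ} {x y : ℚ} (hx : ExactTwoPow m x) (hy : DvdTwoPow (m + 1) y) :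
    ExactTwoPow m (x + y) := by
  obtain ⟨p, q, hp, hq, e⟩ := hx
  obtain ⟨p', q', hq', e'⟩ := hy
  refine ⟨p * q' + 2 * (p' * q), q * q', (hp.mul hq').add_even (even_two_mul _), hq.mul hq', ?_⟩
  rw [zpow_add_one₀ (by norm_num)] at e'
  push_cast
  linear_combination q' * e + q * e'

theorem ExactTwoPow.add_exactTwoPow {m : ℤ} {x y : ℚ} (hx : ExactTwoPow m x)
    (hy : ExactTwoPow m y) : DvdTwoPow (m + 1) (x + y) := by
  obtain ⟨p, q, hp, hq, e⟩ := hx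
  obtain ⟨p', q', hp', hq', e'⟩ := hy
  obtain ⟨t, ht⟩ := (hp.mul hq').add_odd (hp'.mul hq)
  refine ⟨t, q * q', hq.mul hq', ?_⟩
  have ht' : (p * q' + p' * q : ℚ) = t + t := by exact_mod_cast ht
  rw [zpow_add_one₀ (by norm_num)]
  push_cast
  linear_combination q' * e + q * e' + 2 ^ m * ht'

theorem DvdTwoPow.natCast (x : ℕ) : DvdTwoPow 0 x := ⟨x, 1, odd_one, by simp⟩

theorem ExactTwoPow.pow (m : ℕ) : ExactTwoPow m (2 ^ m) := ⟨1, 1, odd_one, odd_one, by simp⟩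

theorem ExactTwoPow.two : ExactTwoPow 1 2 := ⟨1, 1, odd_one, odd_one, by simp⟩

theorem ExactTwoPow.intCast_of_odd {x : ℤ} (hx : Odd x) : ExactTwoPow 0 x :=
  ⟨x, 1, hx, odd_one, by simp⟩

theorem ExactTwoPow.natCast_padicValNat {x : ℕ} (hx : x ≠ 0) :
    ExactTwoPow (padicValNat 2 x) x := by
  obtain ⟨y, hy⟩ := pow_padicValNat_dvd (p := 2) (n := x)
  have hodd : ¬ 2 ∣ y := by
    rintro ⟨z, rfl⟩
    apply pow_succ_padicValNat_not_dvd (p := 2) hx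
    exact ⟨z, by conv_lhs => rw [hy]
                 ring⟩
  refine ⟨y, 1, ?_, odd_one, ?_⟩
  · rw [Int.odd_iff]; omega
  · rw [zpow_natCast]
    push_cast
    rw [mul_one]
    exact_mod_cast hy

theorem ExactTwoPow.not_dvdTwoPow {m m' : ℤ} {x : ℚ} (hx : ExactTwoPow m x) (h : m < m') :
    ¬ DvdTwoPow m' x := by
  intro hd
  obtain ⟨p', q', hq', e'⟩ := hd.mono (show m + 1 ≤ m' by omega)
  obtain ⟨p, q, hp, hq, e⟩ := hx
  have h3 : (2 : ℚ) ^ m ≠ 0 := zpow_ne_zero _ (by norm_num)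
  rw [zpow_add_one₀ (by norm_num)] at e'
  have e3 : (2 : ℚ) ^ m * (p * q') = 2 ^ m * (2 * (p' * q)) := by
    linear_combination q * e' - q' * e
  have e4 : p * q' = 2 * (p' * q) := by exact_mod_cast mul_left_cancel₀ h3 e3
  have := hp.mul hq'
  rw [e4] at this
  exact (Int.not_odd_iff_even.2 (even_two_mul _)) this

theorem ExactTwoPow.ne_zero {m : ℤ} {x : ℚ} (hx : ExactTwoPow m x) : x ≠ 0 := by
  rintro rfl
  exact hx.not_dvdTwoPow (lt_add_one m) (DvdTwoPow.zero _)

theorem DvdTwoPow.le_padicValNat {m : ℤ} {x : ℕ} (hx : x ≠ 0) (h : DvdTwoPow m x) :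
    m ≤ padicValNat 2 x := by
  by_contra hlt
  exact (ExactTwoPow.natCast_padicValNat hx).not_dvdTwoPow (not_le.1 hlt) h

theorem ExactTwoPow.padicValNat_eq {m : ℤ} {x : ℕ} (h : ExactTwoPow m x) :
    (padicValNat 2 x : ℤ) = m := by
  have hx : x ≠ 0 := by
    have := h.ne_zero
    exact_mod_cast this
  apply le_antisymm _ (h.dvdTwoPow.le_padicValNat hx)
  by_contra hlt
  exact h.not_dvdTwoPow (not_le.1 hlt) (ExactTwoPow.natCast_padicValNat hx).dvdTwoPow

/-! ### Stirling numbers as alternating sums -/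

theorem factorial_mul_stirlingSecond (n k : ℕ) :
    ((k.factorial * Nat.stirlingSecond n k : ℕ) : ℤ)
      = ∑ j ∈ range (k + 1), (-1) ^ (k + j) * (k.choose j : ℤ) * (j : ℤ) ^ n := by
  induction n generalizing k with
  | zero =>
    have h := Int.alternating_sum_range_choose (n := k)
    simp only [pow_zero, mul_one, pow_add, mul_assoc, ← Finset.mul_sum]
    rw [h]
    rcases k with _ | k <;> simp
  | succ n ih =>
    rcases k with _ | k
    · simp
    rw [Nat.stirlingSecond_succ_succ]
    have h1 := ih (k + 1)
    have h2 := ih k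
    have h3 : ((k + 1).factorial * ((k + 1) * Nat.stirlingSecond n (k + 1)
        + Nat.stirlingSecond n k) : ℕ)
        = ((k + 1 : ℕ) : ℤ) * (((k + 1).factorial * Nat.stirlingSecond n (k + 1) : ℕ)
          + ((k.factorial * Nat.stirlingSecond n k : ℕ) : ℤ)) := by
      rw [Nat.factorial_succ]; push_cast; ring
    rw [h3, h1, h2]
    have h4 : ∑ j ∈ range (k + 1), (-1 : ℤ) ^ (k + j) * (k.choose j : ℤ) * (j : ℤ) ^ n
        = ∑ j ∈ range (k + 1 + 1), (-1 : ℤ) ^ (k + j) * (k.choose j : ℤ) * (j : ℤ) ^ n := by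
      rw [Finset.sum_range_succ _ (k + 1), Nat.choose_succ_self]
      simp
    rw [h4, ← Finset.sum_add_distrib, Finset.mul_sum]
    refine Finset.sum_congr rfl fun j _ => ?_
    rcases j with _ | j
    · simp only [Nat.choose_zero_right]
      -- Since `0 ^ 0 = 1`, the exponent zero is separate: there the two signs on the right cancel.
      rcases n with _ | n
      · simp [pow_succ]
      · simp
    · have h5 : ((k + 1 : ℕ) : ℤ) * k.choose j = (k + 1).choose (j + 1) * ((j + 1 : ℕ) : ℤ) := by
        exact_mod_cast Nat.add_one_mul_choose_eq k j
      have h6 : ((k + 1).choose (j + 1) : ℤ) = k.choose j + k.choose (j + 1) := by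
        exact_mod_cast Nat.choose_succ_succ k j
      rw [show (-1 : ℤ) ^ (k + 1 + (j + 1)) = (-1) ^ (k + j) by
          rw [show k + 1 + (j + 1) = k + j + 2 by ring, pow_add]; simp,
        show (-1 : ℤ) ^ (k + (j + 1)) = -(-1) ^ (k + j) by
          rw [← add_assoc, pow_succ]; ring]
      linear_combination (-1 : ℤ) ^ (k + j) * ((j + 1 : ℕ) : ℤ) ^ n * (h5 + ((k + 1 : ℕ) : ℤ) * h6)

theorem stirlingSecond_pos {n k : ℕ} (hk : 1 ≤ k) (hkn : k ≤ n) :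
    0 < Nat.stirlingSecond n k := by
  induction n generalizing k with
  | zero => omega
  | succ n ih =>
    obtain ⟨k, rfl⟩ : ∃ k', k = k' + 1 := ⟨k - 1, by omega⟩
    rw [Nat.stirlingSecond_succ_succ]
    rcases Nat.lt_or_ge n (k + 1) with h | h
    · have : n = k := by omega
      subst this
      rw [Nat.stirlingSecond_self]
      omega
    · have := ih (k := k + 1) (by omega) h
      positivity

/-- The freedom in `R` allows one common range for all `r` in `odd_pow_eq_sum`. -/
theorem pow_eq_sum_stirlingSecond_mul_choose (i r R : ℕ) (hR : r < R) :
    i ^ r = ∑ d ∈ range R, Nat.stirlingSecond r d * d.factorial * i.choose d := by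
  induction r generalizing R with
  | zero =>
    obtain ⟨R, rfl⟩ : ∃ R', R = R' + 1 := ⟨R - 1, by omega⟩
    rw [Finset.sum_range_succ']
    simp
  | succ r ih =>
    obtain ⟨R, rfl⟩ : ∃ R', R = R' + 1 := ⟨R - 1, by omega⟩
    rw [Finset.sum_range_succ', pow_succ, ih R (by omega), Finset.sum_mul]
    have e1 : ∀ d, Nat.stirlingSecond r d * d.factorial * i.choose d * i
        = Nat.stirlingSecond r d * (d + 1).factorial * i.choose (d + 1)
          + d * (Nat.stirlingSecond r d * d.factorial * i.choose d) := by
      intro d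
      have h := Nat.choose_succ_right_eq i d
      rcases le_or_gt d i with hd | hd
      · obtain ⟨t, rfl⟩ := Nat.exists_eq_add_of_le hd
        rw [Nat.add_sub_cancel_left] at h
        rw [Nat.factorial_succ]
        zify at h ⊢
        linear_combination -(Nat.stirlingSecond r d * d.factorial) * h
      · rw [Nat.choose_eq_zero_of_lt hd, Nat.choose_eq_zero_of_lt (by omega)]
        simp
    simp only [e1, Nat.stirlingSecond_succ_succ]
    rw [Finset.sum_add_distrib]
    have e2 : ∑ d ∈ range R, d * (Nat.stirlingSecond r d * d.factorial * i.choose d)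
        = ∑ d ∈ range R, (d + 1) * (Nat.stirlingSecond r (d + 1) * (d + 1).factorial
          * i.choose (d + 1)) := by
      have h1 := Finset.sum_range_succ'
        (fun d => d * (Nat.stirlingSecond r d * d.factorial * i.choose d)) R
      have h2 := Finset.sum_range_succ
        (fun d => d * (Nat.stirlingSecond r d * d.factorial * i.choose d)) R
      rw [Nat.stirlingSecond_eq_zero_of_lt (show r < R by omega)] at h2
      simp only [zero_mul, mul_zero, add_zero] at h1 h2
      rw [← h2, h1]
    rw [e2, ← Finset.sum_add_distrib]
    simp only [Nat.stirlingSecond_succ_zero, zero_mul, add_zero]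
    refine Finset.sum_congr rfl fun d _ => ?_
    ring

/-! ### Sums of binomial coefficients over even indices -/

/-- The sum over the even indices `2 * i` of `m.choose (2 * i) * i.choose d`. -/
def evenChooseSum (m d : ℕ) : ℕ := ∑ i ∈ range (m + 1), m.choose (2 * i) * i.choose d

theorem evenChooseSum_eq {m d M : ℕ} (hM : m + 1 ≤ M) :
    ∑ i ∈ range M, m.choose (2 * i) * i.choose d = evenChooseSum m d := by
  unfold evenChooseSum
  symm
  apply Finset.sum_subset
  · intro i hi
    simp only [mem_range] at hi ⊢
    omega
  · intro i _ hi
    simp only [mem_range] at hi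
    rw [Nat.choose_eq_zero_of_lt (by omega), zero_mul]

/-- Compares coefficients in `(1 + X) ^ m * ((1 + X) - 1) ^ 2 = X ^ 2 * (1 + X) ^ m`. -/
theorem choose_add_two_add_choose (m i : ℕ) :
    (m + 2).choose (2 * (i + 1)) + m.choose (2 * (i + 1))
      = 2 * (m + 1).choose (2 * (i + 1)) + m.choose (2 * i) := by
  rw [show 2 * (i + 1) = 2 * i + 1 + 1 by ring]
  rw [Nat.choose_succ_succ (m + 1), Nat.choose_succ_succ m, Nat.choose_succ_succ m]
  ring

theorem evenChooseSum_succ (m d : ℕ) :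
    evenChooseSum (m + 2) (d + 1) = 2 * evenChooseSum (m + 1) (d + 1) + evenChooseSum m d := by
  have h1 := evenChooseSum_eq (m := m + 2) (d := d + 1) (M := m + 4) (by omega)
  have h2 := evenChooseSum_eq (m := m + 1) (d := d + 1) (M := m + 4) (by omega)
  have h3 := evenChooseSum_eq (m := m) (d := d + 1) (M := m + 4) (by omega)
  have h4 := evenChooseSum_eq (m := m) (d := d) (M := m + 3) (by omega)
  have h5 := evenChooseSum_eq (m := m) (d := d + 1) (M := m + 3) (by omega)
  rw [Finset.sum_range_succ'] at h1 h2 h3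
  simp only [Nat.choose_zero_succ, mul_zero, add_zero] at h1 h2 h3
  have h6 : ∑ i ∈ range (m + 3), ((m + 2).choose (2 * (i + 1)) + m.choose (2 * (i + 1)))
        * (i + 1).choose (d + 1)
      = ∑ i ∈ range (m + 3), (2 * (m + 1).choose (2 * (i + 1)) + m.choose (2 * i))
        * (i + 1).choose (d + 1) :=
    Finset.sum_congr rfl fun i _ => by rw [choose_add_two_add_choose]
  have h7 : ∑ i ∈ range (m + 3), (2 * (m + 1).choose (2 * (i + 1)) + m.choose (2 * i))
        * (i + 1).choose (d + 1)
      = 2 * ∑ i ∈ range (m + 3), (m + 1).choose (2 * (i + 1)) * (i + 1).choose (d + 1)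
        + (∑ i ∈ range (m + 3), m.choose (2 * i) * i.choose d
        + ∑ i ∈ range (m + 3), m.choose (2 * i) * i.choose (d + 1)) := by
    rw [Finset.mul_sum, ← Finset.sum_add_distrib, ← Finset.sum_add_distrib]
    refine Finset.sum_congr rfl fun i _ => ?_
    rw [Nat.choose_succ_succ i d]
    ring
  have h8 : ∑ i ∈ range (m + 3), ((m + 2).choose (2 * (i + 1)) + m.choose (2 * (i + 1)))
        * (i + 1).choose (d + 1)
      = ∑ i ∈ range (m + 3), (m + 2).choose (2 * (i + 1)) * (i + 1).choose (d + 1)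
        + ∑ i ∈ range (m + 3), m.choose (2 * (i + 1)) * (i + 1).choose (d + 1) := by
    rw [← Finset.sum_add_distrib]
    refine Finset.sum_congr rfl fun i _ => ?_
    ring
  omega

theorem evenChooseSum_zero_right (m : ℕ) : evenChooseSum (m + 1) 0 = 2 ^ m := by
  induction m with
  | zero => simp [evenChooseSum, Finset.sum_range_succ]
  | succ m ih =>
    have h1 := evenChooseSum_eq (m := m + 2) (d := 0) (M := m + 4) (by omega)
    have h2 := evenChooseSum_eq (m := m + 1) (d := 0) (M := m + 4) (by omega)
    have h3 := evenChooseSum_eq (m := m) (d := 0) (M := m + 4) (by omega)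
    have h4 := evenChooseSum_eq (m := m) (d := 0) (M := m + 3) (by omega)
    simp only [Nat.choose_zero_right, mul_one] at h1 h2 h3 h4
    rw [Finset.sum_range_succ'] at h1 h2 h3
    simp only [Nat.choose_zero_right, mul_zero] at h1 h2 h3
    have h6 : ∑ i ∈ range (m + 3), ((m + 2).choose (2 * (i + 1)) + m.choose (2 * (i + 1)))
        = ∑ i ∈ range (m + 3), (2 * (m + 1).choose (2 * (i + 1)) + m.choose (2 * i)) :=
      Finset.sum_congr rfl fun i _ => by rw [choose_add_two_add_choose]
    rw [Finset.sum_add_distrib, Finset.sum_add_distrib, ← Finset.mul_sum] at h6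
    rw [pow_succ, show m + 1 + 1 = m + 2 by ring]
    omega

theorem evenChooseSum_eq_zero {m d : ℕ} (h : m < 2 * d) : evenChooseSum m d = 0 := by
  unfold evenChooseSum
  refine Finset.sum_eq_zero fun i _ => ?_
  rcases le_or_gt d i with hd | hd
  · rw [Nat.choose_eq_zero_of_lt (by omega), zero_mul]
  · rw [Nat.choose_eq_zero_of_lt hd, mul_zero]

/-- Double induction along `evenChooseSum_succ`. For `d = e = 0` the truncated `d + e - 1` is zero,
and the second binomial coefficient is 1, as needed. -/
theorem two_mul_evenChooseSum (d e : ℕ) :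
    2 * evenChooseSum (2 * d + e) d
      = 2 ^ e * ((d + e).choose e + (d + e - 1).choose e) := by
  induction d generalizing e with
  | zero =>
    rcases e with _ | e
    · simp [evenChooseSum]
    · rw [show 2 * 0 + (e + 1) = e + 1 by ring, evenChooseSum_zero_right, pow_succ]
      simp [mul_comm]
  | succ d ihd =>
    induction e with
    | zero =>
      have h := ihd 0
      rw [show 2 * (d + 1) + 0 = 2 * d + 2 by ring, evenChooseSum_succ,
        evenChooseSum_eq_zero (by omega)]
      simpa using h
    | succ e ihe =>
      have h := ihd (e + 1)
      rw [show 2 * (d + 1) + (e + 1) = 2 * d + (e + 1) + 2 by ring, evenChooseSum_succ,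
        show 2 * d + (e + 1) + 1 = 2 * (d + 1) + e by ring]
      rw [show d + (e + 1) - 1 = d + e by omega] at h
      rw [show d + 1 + e - 1 = d + e by omega] at ihe
      rw [show d + 1 + (e + 1) - 1 = d + e + 1 by omega,
        show d + 1 + (e + 1) = d + e + 1 + 1 by ring, Nat.choose_succ_succ (d + e + 1) e,
        Nat.choose_succ_succ (d + e) e]
      rw [show d + 1 + e = d + e + 1 by ring] at ihe
      rw [show d + (e + 1) = d + e + 1 by ring, Nat.choose_succ_succ (d + e) e] at h
      rw [pow_succ] at h ⊢
      simp only [Nat.succ_eq_add_one] at h ⊢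
      linear_combination 2 * ihe + h

theorem succ_mul_two_mul_evenChooseSum (d e : ℕ) :
    (e + 1) * (2 * evenChooseSum (2 * d + e + 1) d)
      = 2 ^ (e + 1) * ((2 * d + e + 1) * (d + e).choose d) := by
  have h1 := Nat.add_one_mul_choose_eq (d + e) e
  have h2 := Nat.choose_succ_right_eq (d + e) e
  rw [Nat.add_sub_cancel] at h2
  have h3 : (d + e).choose d = (d + e).choose e := by
    rw [Nat.choose_symm_add]
  rw [show 2 * d + e + 1 = 2 * d + (e + 1) by ring, two_mul_evenChooseSum,
    show d + (e + 1) = d + e + 1 by ring, Nat.add_sub_cancel, h3]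
  linear_combination 2 ^ (e + 1) * h2 - 2 ^ (e + 1) * h1

theorem dvdTwoPow_evenChooseSum (m d : ℕ) :
    DvdTwoPow ((m : ℤ) - 1 - 2 * d) (evenChooseSum m d : ℚ) := by
  rcases Nat.lt_or_ge m (2 * d) with h | h
  · rw [evenChooseSum_eq_zero h]
    simpa using DvdTwoPow.zero _
  · obtain ⟨e, rfl⟩ := Nat.exists_eq_add_of_le h
    have h1 := two_mul_evenChooseSum d e
    refine ⟨((d + e).choose e + (d + e - 1).choose e : ℕ), 1, odd_one, ?_⟩
    have h2 : ((2 * d + e : ℕ) : ℤ) - 1 - 2 * d = (e : ℤ) - 1 := by push_cast; ring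
    rw [h2, zpow_sub_one₀ (by norm_num), zpow_natCast]
    have h3 : (2 : ℚ) * evenChooseSum (2 * d + e) d
      = 2 ^ e * (((d + e).choose e + (d + e - 1).choose e : ℕ) : ℚ) := by exact_mod_cast h1
    rw [Int.cast_one, Int.cast_natCast]
    linear_combination h3 / 2

/-- For even `k` the factor `e + 1 = k - 1 - 2 * d` in `succ_mul_two_mul_evenChooseSum` is odd, so
the whole valuation of the binomial coefficient is gained over `dvdTwoPow_evenChooseSum`. -/
theorem dvdTwoPow_evenChooseSum_of_odd {k d : ℕ} (hk : Even k) (hd : 2 * d + 2 ≤ k) :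
    DvdTwoPow (((k - 1 : ℕ) : ℤ) - 1 - 2 * d + padicValNat 2 ((k - d - 2).choose d))
      (evenChooseSum (k - 1) d : ℚ) := by
  obtain ⟨e, rfl⟩ := Nat.exists_eq_add_of_le hd
  have he : Even e := by
    have h2 : Even (2 * d + 2) := ⟨d + 1, by ring⟩
    exact (Nat.even_add.1 hk).1 h2
  rw [show 2 * d + 2 + e - d - 2 = d + e by omega,
    show 2 * d + 2 + e - 1 = 2 * d + e + 1 by omega]
  have h1 := succ_mul_two_mul_evenChooseSum d e
  obtain ⟨t, ht⟩ := pow_padicValNat_dvd (p := 2) (n := (d + e).choose d)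
  set z := padicValNat 2 ((d + e).choose d)
  refine ⟨((2 * d + e + 1) * t : ℕ), (e + 1 : ℕ), ?_, ?_⟩
  · obtain ⟨s, rfl⟩ := he
    exact ⟨s, by push_cast; ring⟩
  · have h2 : ((2 * d + e + 1 : ℕ) : ℤ) - 1 - 2 * d + z = ((e + z : ℕ) : ℤ) := by push_cast; ring
    rw [h2, zpow_natCast, Int.cast_natCast, Int.cast_natCast]
    rw [ht] at h1
    have h3 : ((e + 1 : ℕ) : ℚ) * (2 * evenChooseSum (2 * d + e + 1) d)
      = 2 ^ (e + 1) * (((2 * d + e + 1 : ℕ) : ℚ) * (2 ^ z * t)) := by exact_mod_cast h1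
    rw [pow_succ] at h3
    rw [pow_add]
    push_cast at h3 ⊢
    linear_combination h3 / 2

/-! ### The valuation of `2 ^ r * d! * S(r, d) / r!` -/

theorem dvdTwoPow_coeff_pow {f : ℚ⟦X⟧} (hf : ∀ n, DvdTwoPow 1 (coeff n f)) (d n : ℕ) :
    DvdTwoPow d (coeff n (f ^ d)) := by
  induction d generalizing n with
  | zero =>
    rw [pow_zero, coeff_one]
    split_ifs
    · exact_mod_cast DvdTwoPow.natCast 1
    · exact DvdTwoPow.zero _
  | succ d ih =>
    rw [pow_succ, coeff_mul]
    refine DvdTwoPow.sum _ _ fun p _ => ?_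
    push_cast
    exact (ih p.1).mul (hf p.2)

theorem coeff_exp_pow (j n : ℕ) : coeff n (exp ℚ ^ j) = (j : ℚ) ^ n / n.factorial := by
  rw [exp_pow_eq_rescale_exp, coeff_rescale, coeff_exp]
  simp [div_eq_mul_inv]

theorem coeff_exp_sub_one_pow (d n : ℕ) :
    coeff n ((exp ℚ - 1) ^ d)
      = (d.factorial * Nat.stirlingSecond n d : ℕ) / (n.factorial : ℚ) := by
  have h : ((d.factorial * Nat.stirlingSecond n d : ℕ) : ℚ)
      = ∑ j ∈ range (d + 1), (-1) ^ (d + j) * (d.choose j : ℚ) * (j : ℚ) ^ n := by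
    exact_mod_cast congrArg (Int.cast : ℤ → ℚ) (factorial_mul_stirlingSecond n d)
  rw [h, sub_eq_add_neg, add_pow, map_sum, Finset.sum_div]
  refine Finset.sum_congr rfl fun j hj => ?_
  have hj' : j ≤ d := by simpa [Nat.lt_succ_iff] using hj
  have h1 : (exp ℚ ^ j * (-1) ^ (d - j) * (d.choose j : ℚ⟦X⟧) : ℚ⟦X⟧)
      = C ((-1) ^ (d - j) * (d.choose j : ℚ)) * exp ℚ ^ j := by
    simp [map_mul, map_pow]
    ring
  rw [h1, coeff_C_mul, coeff_exp_pow]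
  have h2 : (-1 : ℚ) ^ (d + j) = (-1) ^ (d - j) := by
    obtain ⟨t, rfl⟩ := Nat.exists_eq_add_of_le hj'
    rw [Nat.add_sub_cancel_left, show j + t + j = 2 * j + t by ring, pow_add, pow_mul]
    simp
  rw [h2]
  ring

theorem exactTwoPow_factorial (n : ℕ) :
    ExactTwoPow ((n : ℤ) - sigmaTwo n) (n.factorial : ℚ) := by
  have h := ExactTwoPow.natCast_padicValNat n.factorial_ne_zero
  have h2 := padicValNat_factorial_add_sigmaTwo n
  rwa [show (n : ℤ) - sigmaTwo n = padicValNat 2 n.factorial by omega]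

/-- The number is a coefficient of `(e ^ (2 * X) - 1) ^ d`, and `2 ^ n / n!` has valuation `σ(n) ≥
1` for `n ≥ 1`. -/
theorem dvdTwoPow_two_pow_mul_stirlingSecond (r d : ℕ) :
    DvdTwoPow d (2 ^ r * (d.factorial * Nat.stirlingSecond r d : ℕ) / r.factorial : ℚ) := by
  have h1 : coeff r ((rescale (2 : ℚ) (exp ℚ - 1)) ^ d)
      = 2 ^ r * (d.factorial * Nat.stirlingSecond r d : ℕ) / r.factorial := by
    rw [← map_pow, coeff_rescale, coeff_exp_sub_one_pow]
    ring
  rw [← h1]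
  apply dvdTwoPow_coeff_pow
  intro n
  rcases n with _ | n
  · rw [coeff_rescale]
    simpa using DvdTwoPow.zero 1
  · rw [coeff_rescale, map_sub, coeff_exp, coeff_one, if_neg (by omega), sub_zero]
    have h2 := (ExactTwoPow.pow (n + 1)).mul (exactTwoPow_factorial (n + 1)).inv
    have h3 := sigmaTwo_pos (n + 1) (by omega)
    simpa using h2.dvdTwoPow.mono (m' := 1) (by push_cast; omega)

/-! ### The contribution of the odd indices -/

theorem choose_add_eq_choose_add_sum (N U r : ℕ) :
    (N + U).choose r = U.choose r + ∑ x ∈ range r, N.choose (x + 1) * U.choose (r - (x + 1)) := by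
  rw [Nat.add_choose_eq, Finset.Nat.sum_antidiagonal_eq_sum_range_succ_mk,
    Finset.sum_range_succ', add_comm]
  simp

/-- Absorption extracts `N / (x + 1)` from the first binomial coefficient and `(y + 1) / (U + 1)`
from the second. The valuations of `x + 1` and `y + 1` then combine with Legendre's formula to shift
the digit sums to `x` and `y + 1`. -/
theorem dvdTwoPow_factorial_mul_choose_mul_choose {h N : ℕ} (hN : 2 ^ h ∣ N) (U x y : ℕ) :
    DvdTwoPow ((h : ℤ) + (x + (y + 1) : ℕ) - sigmaTwo x - sigmaTwo (y + 1)
        - padicValNat 2 (U + 1))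
      ((x + (y + 1)).factorial * (N.choose (x + 1) * U.choose y) : ℚ) := by
  rcases N with _ | N
  · simpa using DvdTwoPow.zero _
  have e1 : ((N + 1).choose (x + 1) : ℚ)
      = (N + 1 : ℕ) * N.choose x * ((x + 1 : ℕ) : ℚ)⁻¹ := by
    have h1 : ((N + 1 : ℕ) : ℚ) * N.choose x = (N + 1).choose (x + 1) * (x + 1 : ℕ) := by
      exact_mod_cast Nat.add_one_mul_choose_eq N x
    rw [h1, mul_inv_cancel_right₀ (by positivity)]
  have e2 : (U.choose y : ℚ)
      = (y + 1 : ℕ) * (U + 1).choose (y + 1) * ((U + 1 : ℕ) : ℚ)⁻¹ := by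
    have h1 : ((U + 1 : ℕ) : ℚ) * U.choose y = (U + 1).choose (y + 1) * (y + 1 : ℕ) := by
      exact_mod_cast Nat.add_one_mul_choose_eq U y
    rw [mul_comm ((y + 1 : ℕ) : ℚ), ← h1, mul_comm ((U + 1 : ℕ) : ℚ),
      mul_inv_cancel_right₀ (by positivity)]
  have d0 : DvdTwoPow h ((N + 1 : ℕ) : ℚ) := by
    obtain ⟨t, ht⟩ := hN
    refine ⟨t, 1, odd_one, ?_⟩
    rw [zpow_natCast, Int.cast_one, mul_one]
    exact_mod_cast ht
  have d1 := (d0.mul (DvdTwoPow.natCast (N.choose x))).mul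
    (ExactTwoPow.natCast_padicValNat (show x + 1 ≠ 0 by omega)).inv.dvdTwoPow
  have d2 := ((ExactTwoPow.natCast_padicValNat (show y + 1 ≠ 0 by omega)).dvdTwoPow.mul
    (DvdTwoPow.natCast ((U + 1).choose (y + 1)))).mul
    (ExactTwoPow.natCast_padicValNat (show U + 1 ≠ 0 by omega)).inv.dvdTwoPow
  have d3 := (exactTwoPow_factorial (x + (y + 1))).dvdTwoPow
  have s1 := sigmaTwo_add_le (x + 1) y
  rw [show x + 1 + y = x + (y + 1) by ring] at s1
  have s2 := sigmaTwo_succ_add_padicValNat x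
  have s3 := sigmaTwo_succ_add_padicValNat y
  rw [e1, e2]
  refine (d3.mul (d1.mul d2)).mono ?_
  omega

theorem dvdTwoPow_factorial_mul_choose_sub {h N : ℕ} (hN : 2 ^ h ∣ N) (U r : ℕ) (B : ℤ)
    (hB : ∀ x v : ℕ, 1 ≤ v → v ≤ U + 1 → x + v = r →
      B ≤ (h : ℤ) + r - sigmaTwo x - sigmaTwo v - padicValNat 2 (U + 1)) :
    DvdTwoPow B (r.factorial * ((N + U).choose r - U.choose r) : ℚ) := by
  rw [choose_add_eq_choose_add_sum]
  push_cast
  rw [add_sub_cancel_left, Finset.mul_sum]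
  refine DvdTwoPow.sum _ _ fun x hx => ?_
  rw [mem_range] at hx
  obtain ⟨y, rfl⟩ : ∃ y, r = x + (y + 1) := ⟨r - (x + 1), by omega⟩
  rw [show x + (y + 1) - (x + 1) = y by omega]
  rcases le_or_gt y U with hy | hy
  · exact (dvdTwoPow_factorial_mul_choose_mul_choose hN U x y).mono
      (hB x (y + 1) (by omega) (by omega) rfl)
  · rw [Nat.choose_eq_zero_of_lt hy]
    simpa using DvdTwoPow.zero _

theorem odd_pow_eq_sum (i M R : ℕ) (hR : M < R) :
    ((2 * i + 1 : ℕ) : ℚ) ^ M = ∑ r ∈ range R, ∑ d ∈ range R,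
      (2 ^ r * (d.factorial * Nat.stirlingSecond r d : ℕ) / r.factorial : ℚ)
        * (r.factorial * M.choose r) * i.choose d := by
  have h1 : ((2 * i + 1 : ℕ) : ℚ) ^ M = ∑ r ∈ range R, 2 ^ r * (i : ℚ) ^ r * M.choose r := by
    push_cast
    rw [add_pow]
    simp only [one_pow, mul_one, mul_pow]
    apply Finset.sum_subset
    · intro r hr
      simp only [mem_range] at hr ⊢
      omega
    · intro r _ hr
      simp only [mem_range] at hr
      rw [Nat.choose_eq_zero_of_lt (by omega)]
      simp
  rw [h1]
  refine Finset.sum_congr rfl fun r hr => ?_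
  rw [mem_range] at hr
  have h2 : (i : ℚ) ^ r
      = ∑ d ∈ range R, (Nat.stirlingSecond r d * d.factorial * i.choose d : ℚ) := by
    exact_mod_cast congrArg (Nat.cast : ℕ → ℚ) (pow_eq_sum_stirlingSecond_mul_choose i r R hr)
  rw [h2, Finset.mul_sum, Finset.sum_mul]
  refine Finset.sum_congr rfl fun d _ => ?_
  have : (r.factorial : ℚ) ≠ 0 := by positivity
  push_cast
  field_simp

theorem sum_choose_mul_odd_pow_sub (m N U R : ℕ) (hR : N + U < R) :
    ∑ i ∈ range (m + 1), (m.choose (2 * i) : ℚ)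
        * (((2 * i + 1 : ℕ) : ℚ) ^ (N + U) - ((2 * i + 1 : ℕ) : ℚ) ^ U)
      = ∑ r ∈ range R, ∑ d ∈ range R,
        (2 ^ r * (d.factorial * Nat.stirlingSecond r d : ℕ) / r.factorial : ℚ)
        * (r.factorial * ((N + U).choose r - U.choose r)) * evenChooseSum m d := by
  have h1 : ∀ i ∈ range (m + 1), (m.choose (2 * i) : ℚ)
        * (((2 * i + 1 : ℕ) : ℚ) ^ (N + U) - ((2 * i + 1 : ℕ) : ℚ) ^ U)
      = ∑ r ∈ range R, ∑ d ∈ range R,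
        (2 ^ r * (d.factorial * Nat.stirlingSecond r d : ℕ) / r.factorial : ℚ)
        * (r.factorial * ((N + U).choose r - U.choose r))
          * (m.choose (2 * i) * i.choose d) := by
    intro i _
    rw [odd_pow_eq_sum i (N + U) R hR, odd_pow_eq_sum i U R (by omega),
      ← Finset.sum_sub_distrib, Finset.mul_sum]
    refine Finset.sum_congr rfl fun r _ => ?_
    rw [← Finset.sum_sub_distrib, Finset.mul_sum]
    refine Finset.sum_congr rfl fun d _ => ?_
    ring
  rw [Finset.sum_congr rfl h1, Finset.sum_comm]
  refine Finset.sum_congr rfl fun r _ => ?_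
  rw [Finset.sum_comm]
  refine Finset.sum_congr rfl fun d _ => ?_
  rw [← Finset.mul_sum]
  unfold evenChooseSum
  push_cast
  rfl

theorem dvdTwoPow_sum_choose_mul_odd_pow_sub {h k u N : ℕ} (hk : 1 ≤ k) (hkh : k ≤ 2 ^ h)
    (hN : 2 ^ h ∣ N) (hu : 1 ≤ u) (huk : u ≤ 2 ^ padicValNat 2 k) (hlt : u < k) :
    DvdTwoPow (((k - 1 : ℕ) : ℤ) - padicValNat 2 u)
      (∑ i ∈ range (k - 1 + 1), ((k - 1).choose (2 * i) : ℚ)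
        * (((2 * i + 1 : ℕ) : ℚ) ^ (N + (u - 1)) - ((2 * i + 1 : ℕ) : ℚ) ^ (u - 1))) := by
  have hdvd : 2 ^ padicValNat 2 k ∣ k := pow_padicValNat_dvd
  have hah : padicValNat 2 k ≤ h :=
    (Nat.pow_le_pow_iff_right (by norm_num)).1 ((Nat.le_of_dvd hk hdvd).trans hkh)
  have h1h : 1 ≤ h := by
    rcases h with _ | h
    · simp at hkh; omega
    · omega
  rw [sum_choose_mul_odd_pow_sub (k - 1) N (u - 1) (N + (u - 1) + 1) (by omega)]
  refine DvdTwoPow.sum _ _ fun r _ => DvdTwoPow.sum _ _ fun d _ => ?_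
  rcases Nat.lt_or_ge (k - 1) (2 * d) with hd | hd
  · rw [evenChooseSum_eq_zero hd]
    simpa using DvdTwoPow.zero _
  rcases Nat.lt_or_ge r d with hrd | hrd
  · rw [Nat.stirlingSecond_eq_zero_of_lt hrd]
    simpa using DvdTwoPow.zero _
  rcases Nat.eq_zero_or_pos d with rfl | hd0
  · rcases r with _ | r
    · simpa using DvdTwoPow.zero _
    · simpa using DvdTwoPow.zero _
  -- Here `z` is the gain in the even-index sum beyond `k - 2 - 2 * d`. The three factors contribute
  -- `d`, `d + 1 - ν(u) - z` and `k - 2 - 2 * d + z`, which add up to `k - 1 - ν(u)`.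
  have key : ∀ z : ℕ,
      DvdTwoPow (((k - 1 : ℕ) : ℤ) - 1 - 2 * d + z) (evenChooseSum (k - 1) d : ℚ) →
      (∀ x v : ℕ, 1 ≤ v → v ≤ u → x + v = r → sigmaTwo x + sigmaTwo v + 1 ≤ h + (r - d) + z) →
      DvdTwoPow (((k - 1 : ℕ) : ℤ) - padicValNat 2 u)
        ((2 ^ r * (d.factorial * Nat.stirlingSecond r d : ℕ) / r.factorial : ℚ)
        * (r.factorial * ((N + (u - 1)).choose r - (u - 1).choose r))
          * evenChooseSum (k - 1) d) := by
    intro z hz hxv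
    have d1 := dvdTwoPow_factorial_mul_choose_sub hN (u - 1) r
      ((d : ℤ) + 1 - padicValNat 2 u - z) (by
        intro x v h1 h2 h3
        rw [Nat.sub_add_cancel hu] at h2 ⊢
        have := hxv x v h1 h2 h3
        omega)
    refine (((dvdTwoPow_two_pow_mul_stirlingSecond r d).mul d1).mul hz).mono ?_
    omega
  rcases Nat.even_or_odd k with hev | hodd
  · have hd2 : 2 * d + 2 ≤ k := by
      obtain ⟨t, rfl⟩ := hev
      omega
    refine key _ (dvdTwoPow_evenChooseSum_of_odd hev hd2) ?_
    rintro x v h1 h2 rfl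
    exact sigmaTwo_add_sigmaTwo_le_choose_of_le hdvd hkh hah h1h (h2.trans huk) hrd hd2
  · have hu1 : u = 1 := by
      rw [padicValNat.eq_zero_of_not_dvd (by
        rw [← even_iff_two_dvd]; exact Nat.not_even_iff_odd.2 hodd)] at huk
      omega
    refine key 0 (by simpa using dvdTwoPow_evenChooseSum (k - 1) d) ?_
    rintro x v h1 h2 rfl
    have hv1 : v = 1 := by omega
    subst hv1
    have hne : k ≠ 2 ^ h := by
      rintro rfl
      exact (Nat.not_even_iff_odd.2 hodd) ((Nat.even_pow.2 ⟨even_two, by omega⟩))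
    have := sigmaTwo_le_of_odd (h := h) hd0 hrd (by omega)
    rw [sigmaTwo_one]
    omega

/-! ### Separating the even and the odd indices -/

theorem sum_range_two_mul {M : Type*} [AddCommMonoid M] (f : ℕ → M) (n : ℕ) :
    ∑ j ∈ range (2 * n), f j = ∑ i ∈ range n, f (2 * i) + ∑ i ∈ range n, f (2 * i + 1) := by
  induction n with
  | zero => simp
  | succ n ih =>
    rw [show 2 * (n + 1) = 2 * n + 1 + 1 by ring, Finset.sum_range_succ, Finset.sum_range_succ,
      ih, Finset.sum_range_succ, Finset.sum_range_succ]
    abel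

theorem sum_choose_mul_eq_even_add_odd (k : ℕ) (f : ℕ → ℚ) :
    ∑ j ∈ range (k + 1), (k.choose j : ℚ) * f j
      = ∑ i ∈ range (k + 1), (k.choose (2 * i) : ℚ) * f (2 * i)
        + ∑ i ∈ range (k + 1), (k.choose (2 * i + 1) : ℚ) * f (2 * i + 1) := by
  rw [← sum_range_two_mul (fun j => (k.choose j : ℚ) * f j)]
  apply Finset.sum_subset
  · intro j hj
    simp only [mem_range] at hj ⊢
    omega
  · intro j _ hj
    simp only [mem_range] at hj
    rw [Nat.choose_eq_zero_of_lt (by omega)]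
    simp

theorem neg_one_pow_mul_factorial_mul_stirlingSecond (n k : ℕ) :
    (-1) ^ k * ((k.factorial * Nat.stirlingSecond n k : ℕ) : ℚ)
      = ∑ i ∈ range (k + 1), (k.choose (2 * i) : ℚ) * ((2 * i : ℕ) : ℚ) ^ n
        - ∑ i ∈ range (k + 1), (k.choose (2 * i + 1) : ℚ) * ((2 * i + 1 : ℕ) : ℚ) ^ n := by
  have h : ((k.factorial * Nat.stirlingSecond n k : ℕ) : ℚ)
      = ∑ j ∈ range (k + 1), (-1) ^ (k + j) * (k.choose j : ℚ) * (j : ℚ) ^ n := by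
    exact_mod_cast congrArg (Int.cast : ℤ → ℚ) (factorial_mul_stirlingSecond n k)
  have h2 : (-1) ^ k * ((k.factorial * Nat.stirlingSecond n k : ℕ) : ℚ)
      = ∑ j ∈ range (k + 1), (k.choose j : ℚ) * ((-1) ^ j * (j : ℚ) ^ n) := by
    rw [h, Finset.mul_sum]
    refine Finset.sum_congr rfl fun j _ => ?_
    have : ((-1 : ℚ) ^ k) * (-1) ^ k = 1 := by rw [← mul_pow]; simp
    rw [pow_add]
    linear_combination (-1) ^ j * (k.choose j : ℚ) * (j : ℚ) ^ n * this
  rw [h2, sum_choose_mul_eq_even_add_odd, sub_eq_add_neg, ← Finset.sum_neg_distrib]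
  congr 1
  · refine Finset.sum_congr rfl fun i _ => ?_
    rw [pow_mul]; simp
  · refine Finset.sum_congr rfl fun i _ => ?_
    rw [pow_succ, pow_mul]; simp

/-- Absorbing one factor `2 * i` into the binomial coefficient yields a factor `k` and leaves `(2 *
i) ^ (n - 1)`. -/
theorem dvdTwoPow_sum_even {k n : ℕ} (hk : 1 ≤ k) (hn : 1 ≤ n) :
    DvdTwoPow ((padicValNat 2 k : ℤ) + (n - 1 : ℕ))
      (∑ i ∈ range (k + 1), (k.choose (2 * i) : ℚ) * ((2 * i : ℕ) : ℚ) ^ n) := by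
  refine DvdTwoPow.sum _ _ fun i _ => ?_
  obtain ⟨n, rfl⟩ : ∃ n', n = n' + 1 := ⟨n - 1, by omega⟩
  obtain ⟨k, rfl⟩ : ∃ k', k = k' + 1 := ⟨k - 1, by omega⟩
  rcases i with _ | i
  · simpa using DvdTwoPow.zero _
  have h1 : ((k + 1 : ℕ) : ℚ) * k.choose (2 * i + 1)
      = (k + 1).choose (2 * (i + 1)) * (2 * (i + 1) : ℕ) := by
    exact_mod_cast Nat.add_one_mul_choose_eq k (2 * i + 1)
  have h2 : ((k + 1).choose (2 * (i + 1)) : ℚ) * ((2 * (i + 1) : ℕ) : ℚ) ^ (n + 1)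
      = ((k + 1 : ℕ) : ℚ) * (2 ^ n * ((k.choose (2 * i + 1) * (i + 1) ^ n : ℕ) : ℚ)) := by
    rw [pow_succ]
    push_cast at h1 ⊢
    rw [mul_pow]
    linear_combination (-(2 : ℚ) ^ n * ((i : ℚ) + 1) ^ n) * h1
  rw [h2, Nat.add_sub_cancel]
  refine ((ExactTwoPow.natCast_padicValNat (show k + 1 ≠ 0 by omega)).dvdTwoPow.mul
    ((ExactTwoPow.pow n).dvdTwoPow.mul (DvdTwoPow.natCast _))).mono ?_
  omega

theorem dvdTwoPow_sum_odd_sub {h k u N : ℕ} (hk : 1 ≤ k) (hkh : k ≤ 2 ^ h)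
    (hN : 2 ^ h ∣ N) (hu : 1 ≤ u) (huk : u ≤ 2 ^ padicValNat 2 k) (hlt : u < k) :
    DvdTwoPow ((k : ℤ) + padicValNat 2 k - 1 - padicValNat 2 u)
      (∑ i ∈ range (k + 1), (k.choose (2 * i + 1) : ℚ) * ((2 * i + 1 : ℕ) : ℚ) ^ (N + u)
        - ∑ i ∈ range (k + 1), (k.choose (2 * i + 1) : ℚ) * ((2 * i + 1 : ℕ) : ℚ) ^ u) := by
  have h1 := dvdTwoPow_sum_choose_mul_odd_pow_sub hk hkh hN hu huk hlt
  have h2 := (ExactTwoPow.natCast_padicValNat (show k ≠ 0 by omega)).dvdTwoPow.mul h1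
  have h3 : ∑ i ∈ range (k + 1), (k.choose (2 * i + 1) : ℚ) * ((2 * i + 1 : ℕ) : ℚ) ^ (N + u)
        - ∑ i ∈ range (k + 1), (k.choose (2 * i + 1) : ℚ) * ((2 * i + 1 : ℕ) : ℚ) ^ u
      = (k : ℚ) * ∑ i ∈ range (k - 1 + 1), ((k - 1).choose (2 * i) : ℚ)
        * (((2 * i + 1 : ℕ) : ℚ) ^ (N + (u - 1)) - ((2 * i + 1 : ℕ) : ℚ) ^ (u - 1)) := by
    obtain ⟨u, rfl⟩ : ∃ u', u = u' + 1 := ⟨u - 1, by omega⟩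
    obtain ⟨k, rfl⟩ : ∃ k', k = k' + 1 := ⟨k - 1, by omega⟩
    simp only [Nat.add_sub_cancel]
    rw [← Finset.sum_sub_distrib, Finset.mul_sum, Finset.sum_range_succ,
      Nat.choose_eq_zero_of_lt (show k + 1 < 2 * (k + 1) + 1 by omega)]
    simp only [Nat.cast_zero, zero_mul, sub_zero, add_zero]
    refine Finset.sum_congr rfl fun i _ => ?_
    have e : ((k + 1 : ℕ) : ℚ) * k.choose (2 * i)
        = (k + 1).choose (2 * i + 1) * (2 * i + 1 : ℕ) := by
      exact_mod_cast Nat.add_one_mul_choose_eq k (2 * i)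
    rw [← add_assoc, pow_succ, pow_succ]
    linear_combination -((((2 * i + 1 : ℕ) : ℚ) ^ (N + u)) - ((2 * i + 1 : ℕ) : ℚ) ^ u) * e
  rw [h3]
  refine h2.mono ?_
  omega

theorem dvdTwoPow_factorial_mul_stirlingSecond_add {h k u c : ℕ} (hk : 1 ≤ k) (hkh : k ≤ 2 ^ h)
    (hu : 1 ≤ u) (huk : u ≤ 2 ^ padicValNat 2 k) (hlt : u < k) (hc : 1 ≤ c) :
    DvdTwoPow ((k : ℤ) + padicValNat 2 k - 1 - padicValNat 2 u)
      ((-1) ^ k * ((k.factorial * Nat.stirlingSecond (c * 2 ^ h + u) k : ℕ) : ℚ)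
        + (∑ j ∈ range (k + 1), (k.choose j : ℚ) * (j : ℚ) ^ u) / 2) := by
  have h1 := neg_one_pow_mul_factorial_mul_stirlingSecond (c * 2 ^ h + u) k
  have h2 := neg_one_pow_mul_factorial_mul_stirlingSecond u k
  -- The even and odd sums with exponent `u` are therefore equal, each being half of the full sum.
  rw [Nat.stirlingSecond_eq_zero_of_lt hlt] at h2
  have h3 := sum_choose_mul_eq_even_add_odd k (fun j => (j : ℚ) ^ u)
  have h4 := dvdTwoPow_sum_odd_sub hk hkh (Dvd.intro_left c rfl) hu huk hlt
  have hch : 2 ^ h ≤ c * 2 ^ h := Nat.le_mul_of_pos_left _ hc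
  have h5 := (dvdTwoPow_sum_even hk (show 1 ≤ c * 2 ^ h + u by omega)).mono
    (show (k : ℤ) + padicValNat 2 k - 1 - padicValNat 2 u ≤ _ by omega)
  have h6 := h5.sub h4
  simp only [mul_zero, Nat.cast_zero] at h2
  convert h6 using 1
  rw [h1, h3]
  linear_combination -h2 / 2

/-! ### The coefficients of the logistic function -/

/-- The exponential generating function `e ^ X / (1 + e ^ X)`. -/
noncomputable def logistic : ℚ⟦X⟧ := exp ℚ * (1 + exp ℚ)⁻¹

/-- The derivatives at zero of the logistic function. -/
noncomputable def logisticCoeff (n : ℕ) : ℚ := n.factorial * coeff n logistic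

theorem logistic_mul : logistic * (1 + exp ℚ) = exp ℚ := by
  unfold logistic
  rw [mul_assoc, PowerSeries.inv_mul_cancel, mul_one]
  simp

theorem derivative_exp' : derivative ℚ (exp ℚ) = exp ℚ := by
  ext n
  rw [coeff_derivative, coeff_exp, coeff_exp, Nat.factorial_succ]
  have : (n.factorial : ℚ) ≠ 0 := by positivity
  simp
  field_simp

theorem one_add_exp_ne_zero : (1 + exp ℚ : ℚ⟦X⟧) ≠ 0 := by
  intro h
  have := congrArg (constantCoeff (R := ℚ)) h
  simp at this

theorem derivative_logistic : derivative ℚ logistic = logistic - logistic ^ 2 := by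
  have h := congrArg (derivative ℚ) logistic_mul
  rw [Derivation.leibniz, map_add, derivative_exp'] at h
  simp only [smul_eq_mul, Derivation.map_one_eq_zero, zero_add] at h
  apply mul_right_cancel₀ one_add_exp_ne_zero
  linear_combination h + (logistic - 1) * logistic_mul

theorem coeff_mul_eq_sum_choose (f g : ℚ⟦X⟧) (n : ℕ) :
    n.factorial * coeff n (f * g) = ∑ i ∈ range (n + 1), (n.choose i : ℚ)
      * (i.factorial * coeff i f) * ((n - i).factorial * coeff (n - i) g) := by
  rw [coeff_mul, Finset.Nat.sum_antidiagonal_eq_sum_range_succ_mk, Finset.mul_sum]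
  refine Finset.sum_congr rfl fun i hi => ?_
  have hi' : i ≤ n := by simpa [Nat.lt_succ_iff] using hi
  have h : ((n.choose i : ℚ) * i.factorial * (n - i).factorial) = n.factorial := by
    exact_mod_cast Nat.choose_mul_factorial_mul_factorial hi'
  rw [← h]
  ring

theorem logisticCoeff_zero : logisticCoeff 0 = 1 / 2 := by
  have h := congrArg (constantCoeff (R := ℚ)) logistic_mul
  simp only [map_mul, map_add, map_one, constantCoeff_exp] at h
  unfold logisticCoeff
  simp only [Nat.factorial_zero, Nat.cast_one, one_mul, coeff_zero_eq_constantCoeff]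
  linarith

/-- The derivatives at zero of `tanh (X / 2)`, namely of `2 * logistic - 1`. -/
noncomputable def tanhCoeff (n : ℕ) : ℚ := n.factorial * coeff n (2 * logistic - 1)

theorem coeff_two_mul_logistic_sub_one (n : ℕ) :
    coeff n (2 * logistic - 1) = 2 * coeff n logistic - if n = 0 then 1 else 0 := by
  rw [map_sub, coeff_one, show (2 : ℚ⟦X⟧) = C 2 from (map_ofNat C 2).symm, coeff_C_mul]

theorem tanhCoeff_zero : tanhCoeff 0 = 0 := by
  have h := logisticCoeff_zero
  unfold tanhCoeff
  unfold logisticCoeff at h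
  rw [coeff_two_mul_logistic_sub_one]
  simp at h ⊢
  linarith

theorem logisticCoeff_succ (n : ℕ) : logisticCoeff (n + 1) = tanhCoeff (n + 1) / 2 := by
  unfold tanhCoeff logisticCoeff
  rw [coeff_two_mul_logistic_sub_one]
  simp
  ring

/-- The function `T = tanh (X / 2)` satisfies `T' = (1 - T ^ 2) / 2`. -/
theorem tanhCoeff_succ (n : ℕ) :
    tanhCoeff (n + 1) = ((if n = 0 then 1 else 0)
      - ∑ i ∈ range (n + 1), (n.choose i : ℚ) * tanhCoeff i * tanhCoeff (n - i)) / 2 := by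
  have h1 : derivative ℚ (2 * logistic - 1)
      = C (1 / 2) * (1 - (2 * logistic - 1) * (2 * logistic - 1)) := by
    have h2 : derivative ℚ (2 : ℚ⟦X⟧) = 0 := by
      rw [show (2 : ℚ⟦X⟧) = C 2 from (map_ofNat C 2).symm]
      exact derivative_C
    have h3 : (C (1 / 2 : ℚ) : ℚ⟦X⟧) * 2 = 1 := by
      rw [show (2 : ℚ⟦X⟧) = C 2 from (map_ofNat C 2).symm, ← map_mul]
      norm_num
    rw [map_sub, Derivation.leibniz, h2, derivative_logistic]
    simp only [smul_eq_mul, Derivation.map_one_eq_zero, mul_zero, add_zero, sub_zero]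
    linear_combination -(2 * (logistic - logistic ^ 2)) * h3
  have h4 := congrArg (fun f => (n.factorial : ℚ) * coeff n f) h1
  simp only [coeff_derivative, coeff_C_mul, map_sub (coeff n) 1, coeff_one] at h4
  have h5 := coeff_mul_eq_sum_choose (2 * logistic - 1) (2 * logistic - 1) n
  unfold tanhCoeff
  rw [← h5, Nat.factorial_succ]
  have h6 : ((n.factorial : ℚ) * if n = 0 then 1 else 0) = if n = 0 then 1 else 0 := by
    rcases n with _ | n <;> simp
  push_cast
  linear_combination h4 + h6 / 2

theorem tanhCoeff_of_even (n : ℕ) (hn : Even n) : tanhCoeff n = 0 := by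
  induction n using Nat.strong_induction_on with
  | _ n ih =>
    rcases n with _ | n
    · exact tanhCoeff_zero
    · rw [Nat.even_add_one, Nat.not_even_iff_odd] at hn
      rw [tanhCoeff_succ, if_neg (by rintro rfl; simp at hn), Finset.sum_eq_zero]
      · simp
      · intro i hi
        rw [mem_range] at hi
        rcases Nat.even_or_odd i with h | h
        · rw [ih i hi h]; ring
        · rw [ih (n - i) (by omega) (Nat.Odd.sub_odd hn h)]; ring

/-- The numbers `(2 * n + 2) * tanhCoeff (2 * n + 1)`, up to sign the Genocchi numbers. -/
noncomputable def genocchi (n : ℕ) : ℚ := (2 * n + 2) * tanhCoeff (2 * n + 1)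

theorem genocchi_zero : genocchi 0 = 1 := by
  unfold genocchi
  rw [show 2 * 0 + 1 = 0 + 1 by ring, tanhCoeff_succ]
  simp [tanhCoeff_zero]

/-- For `p + q = M`, the weights `2 * p + 2` and `2 * q + 2` are absorbed by `(2M+4)(2M+3) * C(2M+2,
2p+1) = C(2M+4, 2p+2) * (2p+2)(2q+2)`. -/
theorem genocchi_succ (M : ℕ) :
    genocchi (M + 1) = -(∑ p ∈ range (M + 1), ((2 * M + 4).choose (2 * p + 2) : ℚ)
      * (genocchi p * genocchi (M - p))) / 2 * ((2 * M + 3 : ℕ) : ℚ)⁻¹ := by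
  have h1 := tanhCoeff_succ (2 * M + 2)
  rw [if_neg (by omega), Finset.sum_range_succ, Nat.sub_self, tanhCoeff_zero, mul_zero, add_zero,
    show 2 * M + 2 = 2 * (M + 1) by ring, sum_range_two_mul, Finset.sum_eq_zero
      (fun i _ => by rw [tanhCoeff_of_even _ (even_two_mul i)]; ring), zero_add, zero_sub] at h1
  have h2 : ((2 * M + 4 : ℕ) : ℚ) * ((2 * M + 3 : ℕ) : ℚ)
      * ∑ i ∈ range (M + 1), ((2 * (M + 1)).choose (2 * i + 1) : ℚ) * tanhCoeff (2 * i + 1)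
        * tanhCoeff (2 * (M + 1) - (2 * i + 1))
      = ∑ p ∈ range (M + 1), ((2 * M + 4).choose (2 * p + 2) : ℚ)
      * (genocchi p * genocchi (M - p)) := by
    rw [Finset.mul_sum]
    refine Finset.sum_congr rfl fun p hp => ?_
    rw [mem_range] at hp
    obtain ⟨q, rfl⟩ : ∃ q, M = p + q := ⟨M - p, by omega⟩
    rw [show 2 * (p + q + 1) - (2 * p + 1) = 2 * q + 1 by omega, Nat.add_sub_cancel_left]
    unfold genocchi
    have e1 : ((2 * (p + q) + 4 : ℕ) : ℚ) * (2 * (p + q) + 3).choose (2 * p + 1)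
        = (2 * (p + q) + 4).choose (2 * p + 2) * (2 * p + 2 : ℕ) := by
      exact_mod_cast Nat.add_one_mul_choose_eq (2 * (p + q) + 3) (2 * p + 1)
    have e2 : ((2 * (p + q) + 3 : ℕ) : ℚ) * (2 * (p + q + 1)).choose (2 * p + 1)
        = (2 * (p + q) + 3).choose (2 * p + 1) * (2 * q + 2 : ℕ) := by
      have := Nat.choose_mul_succ_eq (2 * (p + q) + 2) (2 * p + 1)
      rw [show 2 * (p + q) + 2 + 1 - (2 * p + 1) = 2 * q + 2 by omega] at this
      rw [mul_comm]
      exact_mod_cast this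
    push_cast at e1 e2 ⊢
    linear_combination tanhCoeff (2 * p + 1) * tanhCoeff (2 * q + 1)
      * ((2 * ((p : ℚ) + q) + 4) * e2 + (2 * (q : ℚ) + 2) * e1)
  rw [← h2]
  unfold genocchi
  rw [show 2 * (M + 1) + 1 = 2 * (M + 1) + 1 from rfl, h1]
  push_cast
  field_simp
  ring

theorem sum_choose_even_interior (M : ℕ) :
    ∑ p ∈ range (M + 1), ((2 * M + 4).choose (2 * p + 2) : ℚ) = 2 ^ (2 * M + 3) - 2 := by
  have h1 : ∑ i ∈ range (M + 3), (2 * M + 4).choose (2 * i) = 2 ^ (2 * M + 3) := by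
    have h2 := evenChooseSum_zero_right (2 * M + 3)
    unfold evenChooseSum at h2
    simp only [Nat.choose_zero_right, mul_one] at h2
    rw [← h2]
    apply Finset.sum_subset
    · intro i hi
      simp only [mem_range] at hi ⊢
      omega
    · intro i _ hi
      simp only [mem_range] at hi
      rw [Nat.choose_eq_zero_of_lt (by omega)]
  rw [Finset.sum_range_succ, Finset.sum_range_succ', show 2 * (M + 2) = 2 * M + 4 by ring,
    Nat.choose_self, mul_zero, Nat.choose_zero_right] at h1
  have h3 : ((∑ p ∈ range (M + 1), (2 * M + 4).choose (2 * p + 2) : ℕ) : ℚ) + 1 + 1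
      = 2 ^ (2 * M + 3) := by exact_mod_cast h1
  push_cast at h3
  linarith

/-- Write the earlier values as `1 + 2 * t p` with `t p` 2-integral. The parts linear in `t` are
paired by `p ↦ M - p`, so modulo 4 the convolution is the plain sum of binomial coefficients `2 ^ (2
* M + 3) - 2`, which is 2 modulo 4. Half of it, divided by the odd number `2 * M + 3`, is a 2-adic
unit. -/
theorem exactTwoPow_genocchi (n : ℕ) : ExactTwoPow 0 (genocchi n) := by
  induction n using Nat.strong_induction_on with
  | _ n ih =>
    rcases n with _ | M
    · rw [genocchi_zero]
      exact_mod_cast ExactTwoPow.intCast_of_odd odd_one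
    · rw [genocchi_succ]
      set t : ℕ → ℚ := fun p => (genocchi p - 1) / 2 with ht
      have hg : ∀ p, genocchi p = 1 + 2 * t p := fun p => by simp only [ht]; ring
      have ht0 : ∀ p < M + 1, DvdTwoPow 0 (t p) := by
        intro p hp
        have h1 : ExactTwoPow 0 (-1 : ℚ) := by
          exact_mod_cast ExactTwoPow.intCast_of_odd (odd_neg.2 odd_one)
        have h2 := ((ih p hp).add_exactTwoPow h1).mul ExactTwoPow.two.inv.dvdTwoPow
        simpa [ht, div_eq_mul_inv, sub_eq_add_neg] using h2
      have hsymm : ∑ p ∈ range (M + 1), ((2 * M + 4).choose (2 * p + 2) : ℚ) * t (M - p)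
          = ∑ p ∈ range (M + 1), ((2 * M + 4).choose (2 * p + 2) : ℚ) * t p := by
        rw [← Finset.sum_range_reflect]
        refine Finset.sum_congr rfl fun p hp => ?_
        rw [mem_range] at hp
        rw [show M - (M + 1 - 1 - p) = p by omega,
          show 2 * (M + 1 - 1 - p) + 2 = 2 * M + 4 - (2 * p + 2) by omega,
          Nat.choose_symm (by omega)]
      have hS : ∑ p ∈ range (M + 1), ((2 * M + 4).choose (2 * p + 2) : ℚ)
            * (genocchi p * genocchi (M - p))
          = -2 + (2 ^ (2 * M + 3) + 2 ^ 2 * ∑ p ∈ range (M + 1),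
            ((2 * M + 4).choose (2 * p + 2) : ℚ) * (t p + t p * t (M - p))) := by
        have e : ∀ p ∈ range (M + 1), ((2 * M + 4).choose (2 * p + 2) : ℚ)
            * (genocchi p * genocchi (M - p)) = ((2 * M + 4).choose (2 * p + 2) : ℚ)
            + 2 * (((2 * M + 4).choose (2 * p + 2) : ℚ) * t (M - p))
            - 2 * (((2 * M + 4).choose (2 * p + 2) : ℚ) * t p)
            + 4 * (((2 * M + 4).choose (2 * p + 2) : ℚ) * (t p + t p * t (M - p))) := by
          intro p _
          rw [hg, hg]
          ring
        rw [Finset.sum_congr rfl e, Finset.sum_add_distrib, Finset.sum_sub_distrib,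
          Finset.sum_add_distrib, ← Finset.mul_sum, ← Finset.mul_sum, ← Finset.mul_sum, hsymm,
          sum_choose_even_interior]
        ring
      have hS2 : ExactTwoPow 1 (∑ p ∈ range (M + 1), ((2 * M + 4).choose (2 * p + 2) : ℚ)
            * (genocchi p * genocchi (M - p))) := by
        rw [hS]
        refine ExactTwoPow.two.neg.add (DvdTwoPow.add ?_ ?_)
        · exact (ExactTwoPow.pow _).dvdTwoPow.mono (by push_cast; omega)
        · refine ((ExactTwoPow.pow 2).dvdTwoPow.mul (m' := 0)
            (DvdTwoPow.sum _ _ fun p hp => ?_)).mono (by norm_num)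
          rw [mem_range] at hp
          have h1 := ht0 p hp
          have h2 := ht0 (M - p) (by omega)
          have h3 := (DvdTwoPow.natCast ((2 * M + 4).choose (2 * p + 2))).mul
            (h1.add (by simpa using h1.mul h2))
          simpa using h3
      have h4 : ExactTwoPow 0 ((2 * M + 3 : ℕ) : ℚ) := by
        exact_mod_cast ExactTwoPow.intCast_of_odd (x := ((2 * M + 3 : ℕ) : ℤ))
          ⟨M + 1, by push_cast; ring⟩
      have h5 := (hS2.neg.mul ExactTwoPow.two.inv).mul h4.inv
      simpa [div_eq_mul_inv] using h5

theorem exactTwoPow_logisticCoeff (v : ℕ) (hv : v + 1 = 1 ∨ Even (v + 1)) :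
    ExactTwoPow (-1 - (padicValNat 2 (v + 1) : ℤ)) (logisticCoeff v) := by
  rcases v with _ | v
  · rw [logisticCoeff_zero]
    simpa using ExactTwoPow.two.inv
  · obtain ⟨p, rfl⟩ : ∃ p, v = 2 * p := by
      obtain ⟨t, ht⟩ := hv.resolve_left (by omega)
      exact ⟨t - 1, by omega⟩
    have h1 : logisticCoeff (2 * p + 1)
        = genocchi p * ((2 * p + 1 + 1 : ℕ) : ℚ)⁻¹ * 2⁻¹ := by
      rw [logisticCoeff_succ]
      unfold genocchi
      push_cast
      field_simp
      ring
    rw [h1]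
    have h2 := ((exactTwoPow_genocchi p).mul (ExactTwoPow.natCast_padicValNat
      (show 2 * p + 1 + 1 ≠ 0 by omega)).inv).mul ExactTwoPow.two.inv
    convert h2 using 1
    ring

theorem logisticCoeff_eq_zero (v : ℕ) (hv : Odd (v + 1)) (hv1 : v + 1 ≠ 1) :
    logisticCoeff v = 0 := by
  rcases v with _ | v
  · omega
  · rw [logisticCoeff_succ, tanhCoeff_of_even, zero_div]
    rw [← Nat.not_even_iff_odd, Nat.even_add_one, not_not] at hv
    exact hv

/-! ### The moments of the symmetric binomial distribution -/

/-- The `n`-th moment of the binomial distribution with parameters `k` and `1 / 2`. -/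
noncomputable def binomialMoment (k n : ℕ) : ℚ :=
  (∑ j ∈ range (k + 1), (k.choose j : ℚ) * (j : ℚ) ^ n) / 2 ^ k

theorem coeff_one_add_exp_pow (k n : ℕ) :
    n.factorial * coeff n ((1 + exp ℚ) ^ k) = 2 ^ k * binomialMoment k n := by
  unfold binomialMoment
  rw [mul_div_cancel₀ _ (by positivity), add_comm, add_pow, map_sum, Finset.mul_sum]
  refine Finset.sum_congr rfl fun j _ => ?_
  have h1 : (exp ℚ ^ j * 1 ^ (k - j) * (k.choose j : ℚ⟦X⟧) : ℚ⟦X⟧)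
      = C (k.choose j : ℚ) * exp ℚ ^ j := by
    simp
    ring
  have : (n.factorial : ℚ) ≠ 0 := by positivity
  rw [h1, coeff_C_mul, coeff_exp_pow]
  field_simp

theorem binomialMoment_zero (k : ℕ) : binomialMoment k 0 = 1 := by
  unfold binomialMoment
  have h : (∑ j ∈ range (k + 1), (k.choose j : ℚ)) = 2 ^ k := by
    exact_mod_cast Nat.sum_range_choose k
  simp [h]

/-- The derivative of `(1 + e ^ X) ^ k` is `k * logistic` times the series itself. -/
theorem binomialMoment_succ (k n : ℕ) :
    binomialMoment k (n + 1) = ∑ i ∈ range (n + 1), (k : ℚ) * (n.choose i : ℚ)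
      * logisticCoeff i * binomialMoment k (n - i) := by
  have h1 : derivative ℚ ((1 + exp ℚ) ^ k) = C (k : ℚ) * (logistic * (1 + exp ℚ) ^ k) := by
    rw [Derivation.leibniz_pow, map_add, derivative_exp']
    simp only [Derivation.map_one_eq_zero, zero_add, smul_eq_mul, nsmul_eq_mul, map_natCast]
    rcases k with _ | k
    · simp
    · rw [Nat.add_sub_cancel, pow_succ]
      linear_combination -((k + 1 : ℕ) : ℚ⟦X⟧) * (1 + exp ℚ) ^ k * logistic_mul
  have h2 := congrArg (fun f => (n.factorial : ℚ) * coeff n f) h1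
  simp only [coeff_derivative, coeff_C_mul] at h2
  have h3 := coeff_mul_eq_sum_choose logistic ((1 + exp ℚ) ^ k) n
  have h4 := coeff_one_add_exp_pow k (n + 1)
  have h5 : (2 : ℚ) ^ k ≠ 0 := by positivity
  apply mul_left_cancel₀ h5
  rw [← h4, Nat.factorial_succ, Finset.mul_sum]
  have h6 : ∑ i ∈ range (n + 1), (n.choose i : ℚ) * (i.factorial * coeff i logistic)
        * ((n - i).factorial * coeff (n - i) ((1 + exp ℚ) ^ k))
      = ∑ i ∈ range (n + 1), (n.choose i : ℚ) * logisticCoeff i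
        * (2 ^ k * binomialMoment k (n - i)) :=
    Finset.sum_congr rfl fun i _ => by rw [coeff_one_add_exp_pow]; rfl
  have h7 : ∑ i ∈ range (n + 1), 2 ^ k * ((k : ℚ) * (n.choose i : ℚ)
      * logisticCoeff i * binomialMoment k (n - i))
      = k * ∑ i ∈ range (n + 1), (n.choose i : ℚ) * logisticCoeff i
        * (2 ^ k * binomialMoment k (n - i)) := by
    rw [Finset.mul_sum]
    exact Finset.sum_congr rfl fun i _ => by ring
  rw [h7, ← h6, ← h3]
  push_cast
  linear_combination h2

/-- The exponents `u` at which the `2`-adic valuation of a moment is minimal. -/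
def IsMinimalExponent (a u : ℕ) : Prop :=
  u = 1 ∨ (Even u ∧ 2 * u ≤ 2 ^ a) ∨ 2 * u = 2 + 2 ^ a ∨ u = 2 ^ a

/-- Strictly between 0 and `2 ^ a` the only multiple of `2 ^ (a - 1)` is that number itself. -/
theorem padicValNat_add_two_le {a w : ℕ} (hw : 1 ≤ w) (hwa : w < 2 ^ a)
    (hne : 2 * w ≠ 2 ^ a) : padicValNat 2 w + 2 ≤ a := by
  have hdvd : 2 ^ padicValNat 2 w ∣ w := pow_padicValNat_dvd
  have hle := Nat.le_of_dvd hw hdvd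
  have h1 : padicValNat 2 w < a :=
    (Nat.pow_lt_pow_iff_right (by norm_num)).1 (hle.trans_lt hwa)
  by_contra hcon
  have h2 : a = padicValNat 2 w + 1 := by omega
  obtain ⟨t, ht⟩ := hdvd
  rw [h2, pow_succ] at hwa hne
  generalize 2 ^ padicValNat 2 w = P at *
  have : t < 2 := by
    by_contra h
    have : P * 2 ≤ P * t := Nat.mul_le_mul_left _ (by omega)
    omega
  interval_cases t <;> omega

theorem exactTwoPow_choose {v u : ℕ} (hv : 1 ≤ v) (hvu : v ≤ u) :
    ExactTwoPow ((padicValNat 2 v : ℤ) - padicValNat 2 u + padicValNat 2 (u.choose v))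
      (((u - 1).choose (v - 1) : ℕ) : ℚ) := by
  obtain ⟨v, rfl⟩ : ∃ v', v = v' + 1 := ⟨v - 1, by omega⟩
  obtain ⟨u, rfl⟩ : ∃ u', u = u' + 1 := ⟨u - 1, by omega⟩
  have h1 : ((u + 1 : ℕ) : ℚ) * u.choose v = (u + 1).choose (v + 1) * (v + 1 : ℕ) := by
    exact_mod_cast Nat.add_one_mul_choose_eq u v
  have h2 : ((u.choose v : ℕ) : ℚ)
      = (v + 1 : ℕ) * (u + 1).choose (v + 1) * ((u + 1 : ℕ) : ℚ)⁻¹ := by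
    rw [mul_comm ((v + 1 : ℕ) : ℚ), ← h1, mul_comm ((u + 1 : ℕ) : ℚ),
      mul_inv_cancel_right₀ (by positivity)]
  rw [Nat.add_sub_cancel, Nat.add_sub_cancel, h2]
  have h3 := ((ExactTwoPow.natCast_padicValNat (show v + 1 ≠ 0 by omega)).mul
    (ExactTwoPow.natCast_padicValNat (Nat.choose_pos hvu).ne')).mul
    (ExactTwoPow.natCast_padicValNat (show u + 1 ≠ 0 by omega)).inv
  convert h3 using 1
  ring

theorem padicValNat_choose_half_eq_zero {b v : ℕ} (hv : v < 2 ^ b) :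
    padicValNat 2 ((v + 2 ^ b).choose v) = 0 := by
  have h1 := padicValNat_choose_add_sigmaTwo (Nat.le_add_right v (2 ^ b))
  have h2 := sigmaTwo_pow_mul_add b 1 v hv
  rw [Nat.add_sub_cancel_left] at h1
  rw [one_mul, add_comm, sigmaTwo_one] at h2
  rw [sigmaTwo_two_pow] at h1
  omega

theorem padicValNat_choose_half_self (b : ℕ) :
    padicValNat 2 ((2 ^ b + 2 ^ b).choose (2 ^ b)) = 1 := by
  have h1 := padicValNat_choose_add_sigmaTwo (Nat.le_add_right (2 ^ b) (2 ^ b))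
  have h2 := sigmaTwo_two_pow (b + 1)
  rw [Nat.add_sub_cancel_left, ← two_mul, ← pow_succ', h2, sigmaTwo_two_pow] at h1
  rw [← two_mul, ← pow_succ']
  omega

theorem two_mul_two_pow_eq {a w : ℕ} (hw : 2 * w = 2 ^ a) : ∃ b, a = b + 1 ∧ w = 2 ^ b := by
  rcases a with _ | b
  · simp at hw
  · exact ⟨b, rfl, by rw [pow_succ] at hw; omega⟩

section Moments

variable {k a : ℕ}

/-- The valuation of `v` cancels between the binomial and the logistic coefficient. The exponent is
written as the least value `a - 1 - ν(v + w)` plus the excess of the term. -/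
theorem exactTwoPow_moment_term (hk : k ≠ 0) (ha : padicValNat 2 k = a) {v w : ℕ} (hv : 1 ≤ v)
    (hodd : v = 1 ∨ Even v) (hw : ExactTwoPow ((a : ℤ) - 1 - padicValNat 2 w) (binomialMoment k w)) :
    ExactTwoPow ((a : ℤ) - 1 - padicValNat 2 (v + w)
        + (padicValNat 2 ((v + w).choose v) + a - 1 - padicValNat 2 w))
      ((k : ℚ) * ((v + w - 1).choose (v - 1) : ℕ) * logisticCoeff (v - 1)
        * binomialMoment k w) := by
  have h1 := exactTwoPow_logisticCoeff (v - 1) (by rwa [Nat.sub_add_cancel hv])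
  rw [Nat.sub_add_cancel hv] at h1
  have h2 := (((ExactTwoPow.natCast_padicValNat hk).mul
    (exactTwoPow_choose hv (Nat.le_add_right v w))).mul h1).mul hw
  rw [ha] at h2
  convert h2 using 1
  ring

theorem dvdTwoPow_moment_term (hk : k ≠ 0) (ha : padicValNat 2 k = a) {v w : ℕ} (hv : 1 ≤ v)
    (hw : DvdTwoPow ((a : ℤ) - 1 - padicValNat 2 w) (binomialMoment k w)) :
    DvdTwoPow ((a : ℤ) - 1 - padicValNat 2 (v + w)
        + (padicValNat 2 ((v + w).choose v) + a - 1 - padicValNat 2 w))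
      ((k : ℚ) * ((v + w - 1).choose (v - 1) : ℕ) * logisticCoeff (v - 1)
        * binomialMoment k w) := by
  by_cases hodd : v = 1 ∨ Even v
  · have h1 := exactTwoPow_logisticCoeff (v - 1) (by rwa [Nat.sub_add_cancel hv])
    rw [Nat.sub_add_cancel hv] at h1
    have h2 := (((ExactTwoPow.natCast_padicValNat hk).mul
      (exactTwoPow_choose hv (Nat.le_add_right v w))).mul h1).dvdTwoPow.mul hw
    rw [ha] at h2
    convert h2 using 1
    ring
  · push Not at hodd
    rw [logisticCoeff_eq_zero (v - 1)
      (by rw [Nat.sub_add_cancel hv]; exact Nat.not_even_iff_odd.1 hodd.2)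
      (by rw [Nat.sub_add_cancel hv]; exact hodd.1)]
    simpa using DvdTwoPow.zero _

theorem IsMinimalExponent.half (b : ℕ) : IsMinimalExponent (b + 1) (2 ^ b) := by
  rcases b with _ | b
  · left; rfl
  · right; left
    exact ⟨Nat.even_pow.2 ⟨even_two, by omega⟩, by rw [pow_succ (n := b + 1)]; omega⟩

/-- Among the lower terms of the recursion for the moments only the one of index `2 ^ (a - 1)`
can have the least possible valuation. -/
theorem dvdTwoPow_moment_term_succ (hk : k ≠ 0) (ha : padicValNat 2 k = a) {v w : ℕ}
    (hv : 1 ≤ v) (hw1 : 1 ≤ w) (hu : v + w ≤ 2 ^ a) (hne : 2 * w ≠ 2 ^ a ∨ v + w = 2 ^ a)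
    (hw : DvdTwoPow ((a : ℤ) - 1 - padicValNat 2 w) (binomialMoment k w)) :
    DvdTwoPow ((a : ℤ) - padicValNat 2 (v + w))
      ((k : ℚ) * ((v + w - 1).choose (v - 1) : ℕ) * logisticCoeff (v - 1)
        * binomialMoment k w) := by
  refine (dvdTwoPow_moment_term hk ha hv hw).mono ?_
  by_cases h2 : 2 * w = 2 ^ a
  · have h3 := hne.resolve_left (not_not.2 h2)
    -- Here `v = w`, and the central binomial coefficient supplies the missing factor 2.
    obtain ⟨b, rfl, rfl⟩ := two_mul_two_pow_eq h2
    have h4 : v = 2 ^ b := by rw [pow_succ] at h3; omega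
    subst h4
    rw [padicValNat_choose_half_self, padicValNat.prime_pow]
    push_cast
    omega
  · have := padicValNat_add_two_le hw1 (by omega) h2
    omega

theorem binomialMoment_eq_add (k : ℕ) {u : ℕ} (hu : 1 ≤ u) :
    binomialMoment k u = (k : ℚ) * logisticCoeff (u - 1)
      + ∑ i ∈ range (u - 1), (k : ℚ) * ((u - 1).choose i : ℚ) * logisticCoeff i
        * binomialMoment k (u - 1 - i) := by
  obtain ⟨n, rfl⟩ : ∃ n, u = n + 1 := ⟨u - 1, by omega⟩
  rw [binomialMoment_succ, Finset.sum_range_succ, Nat.add_sub_cancel, Nat.sub_self,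
    binomialMoment_zero, Nat.choose_self]
  ring

theorem exactTwoPow_mul_logisticCoeff (hk : k ≠ 0) (ha : padicValNat 2 k = a) {u : ℕ}
    (hu : 1 ≤ u) (h : u = 1 ∨ Even u) :
    ExactTwoPow ((a : ℤ) - 1 - padicValNat 2 u) ((k : ℚ) * logisticCoeff (u - 1)) := by
  have h1 := exactTwoPow_logisticCoeff (u - 1) (by rwa [Nat.sub_add_cancel hu])
  rw [Nat.sub_add_cancel hu] at h1
  have h2 := (ExactTwoPow.natCast_padicValNat hk).mul h1
  rw [ha] at h2
  convert h2 using 1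
  ring

/-- The term with moment zero attains the least valuation when `u = 1` or `u` is even and vanishes
otherwise. The only possible competitor is the term with moment `2 ^ (a - 1)`, relevant for `2 ^ (a
- 1) < u < 2 ^ a`. -/
theorem binomialMoment_valuation (hk : k ≠ 0) (ha : padicValNat 2 k = a) (u : ℕ) (hu : 1 ≤ u)
    (hua : u ≤ 2 ^ a) :
    (IsMinimalExponent a u →
      ExactTwoPow ((a : ℤ) - 1 - padicValNat 2 u) (binomialMoment k u)) ∧
    (¬ IsMinimalExponent a u → DvdTwoPow ((a : ℤ) - padicValNat 2 u) (binomialMoment k u)) := by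
  induction u using Nat.strong_induction_on with
  | _ u ih =>
    have ih' : ∀ w, 1 ≤ w → w < u →
        DvdTwoPow ((a : ℤ) - 1 - padicValNat 2 w) (binomialMoment k w) := by
      intro w h1 h2
      have h3 := ih w h2 h1 (by omega)
      by_cases hc : IsMinimalExponent a w
      · exact (h3.1 hc).dvdTwoPow
      · exact (h3.2 hc).mono (by omega)
    have hmain0 : ¬ (u = 1 ∨ Even u) → (k : ℚ) * logisticCoeff (u - 1) = 0 := by
      intro h
      push Not at h
      rw [logisticCoeff_eq_zero (u - 1)
        (by rw [Nat.sub_add_cancel hu]; exact Nat.not_even_iff_odd.1 h.2)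
        (by rw [Nat.sub_add_cancel hu]; exact h.1), mul_zero]
    have hterm : ∀ i, i < u - 1 → (2 * (u - 1 - i) ≠ 2 ^ a ∨ u = 2 ^ a) →
        DvdTwoPow ((a : ℤ) - padicValNat 2 u) ((k : ℚ) * ((u - 1).choose i : ℚ)
          * logisticCoeff i * binomialMoment k (u - 1 - i)) := by
      intro i hi hne
      have h1 := dvdTwoPow_moment_term_succ hk ha (v := i + 1) (w := u - 1 - i) (by omega)
        (by omega) (by omega) (by
          rcases hne with h | h
          · exact Or.inl h
          · exact Or.inr (by omega)) (ih' _ (by omega) (by omega))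
      rw [show i + 1 + (u - 1 - i) = u by omega, Nat.add_sub_cancel] at h1
      exact h1
    rw [binomialMoment_eq_add k hu]
    by_cases hA : 2 * u ≤ 2 ^ a ∨ u = 2 ^ a
    · have hR := DvdTwoPow.sum (m := (a : ℤ) - padicValNat 2 u) (range (u - 1))
        (fun i => (k : ℚ) * ((u - 1).choose i : ℚ)
          * logisticCoeff i * binomialMoment k (u - 1 - i)) (by
        intro i hi
        rw [mem_range] at hi
        refine hterm i hi ?_
        rcases hA with h | h
        · left; omega
        · exact Or.inr h)
      by_cases hev : u = 1 ∨ Even u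
      · have h1 := (exactTwoPow_mul_logisticCoeff hk ha hu hev).add
          (hR.mono (show (a : ℤ) - 1 - padicValNat 2 u + 1 ≤ _ by omega))
        refine ⟨fun _ => h1, fun hc => absurd ?_ hc⟩
        rcases hev with h | h
        · exact Or.inl h
        · rcases hA with h2 | h2
          · exact Or.inr (Or.inl ⟨h, h2⟩)
          · exact Or.inr (Or.inr (Or.inr h2))
      · rw [hmain0 hev, zero_add]
        refine ⟨fun hc => absurd ?_ hev, fun _ => hR⟩
        rcases hc with h | h | h | h
        · exact Or.inl h
        · exact Or.inr h.1
        · exact Or.inr ⟨1, by omega⟩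
        · rcases a with _ | a
          · left; simpa using h
          · right; rw [h]; exact Nat.even_pow.2 ⟨even_two, by omega⟩
    -- The range with a competitor: `u = v + 2 ^ b`, where `a = b + 1` and `0 < v < 2 ^ b`. As
    -- `C(u,v)` is odd, the term of index `v - 1` attains the least valuation when `v = 1` or `v` is
    -- even.
    · push Not at hA
      have ha2 : 2 ≤ a := by
        rcases a with _ | _ | a
        · simp only [pow_zero] at hua hA; omega
        · simp only [zero_add, pow_one] at hua hA; omega
        · omega
      obtain ⟨b, rfl⟩ : ∃ b, a = b + 1 := ⟨a - 1, by omega⟩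
      have hpow : 2 ^ (b + 1) = 2 * 2 ^ b := by ring
      have hevb : Even (2 ^ b) := Nat.even_pow.2 ⟨even_two, by omega⟩
      obtain ⟨v, hv1, rfl⟩ : ∃ v, 1 ≤ v ∧ u = v + 2 ^ b := ⟨u - 2 ^ b, by omega, by omega⟩
      have hvb : v < 2 ^ b := by omega
      have h2b : 1 ≤ 2 ^ b := Nat.one_le_two_pow
      have hu1 : v + 2 ^ b ≠ 1 := by omega
      have hevu : Even (v + 2 ^ b) ↔ Even v := by
        rw [Nat.even_add]; exact ⟨fun h => h.2 hevb, fun h => ⟨fun _ => hevb, fun _ => h⟩⟩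
      have hmem : v - 1 ∈ range (v + 2 ^ b - 1) := by rw [mem_range]; omega
      have hR := DvdTwoPow.sum (m := ((b + 1 : ℕ) : ℤ) - padicValNat 2 (v + 2 ^ b))
        ((range (v + 2 ^ b - 1)).erase (v - 1))
        (fun i => (k : ℚ) * ((v + 2 ^ b - 1).choose i : ℚ)
          * logisticCoeff i * binomialMoment k (v + 2 ^ b - 1 - i)) (by
        intro i hi
        rw [mem_erase, mem_range] at hi
        exact hterm i hi.2 (Or.inl (by omega)))
      rw [← Finset.add_sum_erase _ _ hmem]
      rw [show v + 2 ^ b - 1 - (v - 1) = 2 ^ b by omega]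
      have hcond : IsMinimalExponent (b + 1) (v + 2 ^ b) ↔ v = 1 := by
        unfold IsMinimalExponent
        constructor
        · rintro (h | h | h | h) <;> omega
        · rintro rfl
          right; right; left; omega
      by_cases hev : v = 1 ∨ Even v
      · have hs := exactTwoPow_moment_term hk ha hv1 hev
          ((ih (2 ^ b) (by omega) h2b (by omega)).1 (IsMinimalExponent.half b))
        have he : (((b + 1 : ℕ) : ℤ) - 1 - padicValNat 2 (v + 2 ^ b)
            + (padicValNat 2 ((v + 2 ^ b).choose v) + (b + 1 : ℕ) - 1 - padicValNat 2 (2 ^ b)))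
            = ((b + 1 : ℕ) : ℤ) - 1 - padicValNat 2 (v + 2 ^ b) := by
          rw [padicValNat_choose_half_eq_zero hvb, padicValNat.prime_pow]
          push_cast
          ring
        rw [he] at hs
        rcases hev with rfl | hev
        · rw [hmain0 (by
            rw [hevu]
            push Not
            exact ⟨hu1, by decide⟩), zero_add]
          refine ⟨fun _ => hs.add (hR.mono (by omega)), fun hc => absurd (hcond.2 rfl) hc⟩
        -- For even `v` both terms have the least valuation, and their sum gains a factor 2.
        · have hm := exactTwoPow_mul_logisticCoeff hk ha hu (Or.inr (hevu.2 hev))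
          refine ⟨fun hc => ?_, fun _ => ?_⟩
          · rw [hcond] at hc
            subst hc
            exact absurd hev (by decide)
          · rw [← add_assoc]
            exact ((hm.add_exactTwoPow hs).mono (by omega)).add hR
      · rw [hmain0 (by
            rw [hevu]
            push Not at hev ⊢
            exact ⟨hu1, hev.2⟩), zero_add]
        push Not at hev
        rw [logisticCoeff_eq_zero (v - 1)
          (by rw [Nat.sub_add_cancel hv1]; exact Nat.not_even_iff_odd.1 hev.2)
          (by rw [Nat.sub_add_cancel hv1]; exact hev.1), mul_zero, zero_mul, zero_add]
        exact ⟨fun hc => absurd (hcond.1 hc) hev.1, fun _ => hR⟩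

end Moments

/-! ### The value of the shifted almost minimum zero estimate -/

theorem length_bitIndices (n : ℕ) : n.bitIndices.length = sigmaTwo n := by
  induction n using Nat.strong_induction_on with
  | _ n ih =>
    rcases Nat.even_or_odd' n with ⟨m, rfl | rfl⟩
    · rcases Nat.eq_zero_or_pos m with rfl | hm
      · simp [sigmaTwo_zero]
      · rw [Nat.bitIndices_two_mul, List.length_map, ih m (by omega), sigmaTwo_two_mul]
    · rw [Nat.bitIndices_two_mul_add_one, List.length_cons, List.length_map, ih m (by omega),
        sigmaTwo_two_mul_add_one]

theorem card_twoPowers_inter (x y : ℕ) :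
    (twoPowers x ∩ twoPowers y).card = sigmaTwo (x &&& y) := by
  unfold twoPowers
  have hinj : Function.Injective (fun i : ℕ => 2 ^ i) := Nat.pow_right_injective le_rfl
  rw [← Finset.image_inter _ _ hinj, Finset.card_image_of_injective _ hinj,
    ← length_bitIndices, ← List.toFinset_card_of_nodup Nat.bitIndices_nodup]
  congr 1
  ext i
  simp

theorem land_bit (x y b b' : ℕ) (hb : b ≤ 1) (hb' : b' ≤ 1) :
    (2 * x + b) &&& (2 * y + b') = 2 * (x &&& y) + b * b' := by
  have h := fun p q : Bool => Nat.land_bit p x q y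
  interval_cases b <;> interval_cases b'
  · simpa [Nat.bit_val] using h false false
  · simpa [Nat.bit_val] using h false true
  · simpa [Nat.bit_val] using h true false
  · simpa [Nat.bit_val] using h true true

theorem sigmaTwo_land (h c c' r r' : ℕ) (hr : r < 2 ^ h) (hr' : r' < 2 ^ h) :
    sigmaTwo ((c * 2 ^ h + r) &&& (c' * 2 ^ h + r'))
      = sigmaTwo (c &&& c') + sigmaTwo (r &&& r') := by
  induction h generalizing r r' with
  | zero =>
    have h1 : r = 0 := by simpa using hr
    have h2 : r' = 0 := by simpa using hr'
    simp [h1, h2, sigmaTwo_zero]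
  | succ h ih =>
    have e : ∀ c r, c * 2 ^ (h + 1) + r = 2 * (c * 2 ^ h + r / 2) + r % 2 := by
      intro c r
      have := Nat.div_add_mod r 2
      rw [pow_succ]; linarith
    have hb : ∀ r : ℕ, r % 2 ≤ 1 := by intro r; omega
    have e2 : sigmaTwo (r &&& r') = sigmaTwo (r / 2 &&& r' / 2) + r % 2 * (r' % 2) := by
      conv_lhs => rw [← Nat.div_add_mod r 2, ← Nat.div_add_mod r' 2]
      rw [land_bit _ _ _ _ (hb r) (hb r'),
        sigmaTwo_bit _ _ (Nat.mul_le_mul (hb r) (hb r'))]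
    rw [e, e, land_bit _ _ _ _ (hb r) (hb r'),
      sigmaTwo_bit _ _ (Nat.mul_le_mul (hb r) (hb r')), e2,
      ih _ _ (by rw [pow_succ] at hr; omega) (by rw [pow_succ] at hr'; omega)]
    omega

/-- Adding one turns a trailing block `01…1` into `10…0`; only the new digit one of `n + 1` is not
shared. -/
theorem sigmaTwo_land_succ (n : ℕ) : sigmaTwo (n &&& (n + 1)) + 1 = sigmaTwo (n + 1) := by
  induction n using Nat.strong_induction_on with
  | _ n ih =>
    rcases Nat.even_or_odd' n with ⟨m, rfl | rfl⟩
    · have h := land_bit m m 0 1 (by omega) (by omega)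
      rw [add_zero, zero_mul, add_zero, Nat.and_self] at h
      rw [h, sigmaTwo_two_mul, sigmaTwo_two_mul_add_one]
    · have h := land_bit m (m + 1) 1 0 (by omega) (by omega)
      rw [mul_zero, add_zero, add_zero] at h
      rw [show 2 * m + 1 + 1 = 2 * (m + 1) by ring, h, sigmaTwo_two_mul, sigmaTwo_two_mul]
      exact ih m (by omega)

theorem sigmaTwo_land_of_dvd {a u t : ℕ} (hu : 1 ≤ u) (hua : u ≤ 2 ^ a) (ht : 2 ^ a ∣ t) :
    sigmaTwo ((u - 1) &&& (t + u)) + 1 = sigmaTwo u := by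
  obtain ⟨q, rfl⟩ := ht
  rcases hua.lt_or_eq with h | rfl
  · have h1 := sigmaTwo_land a 0 q (u - 1) u (by omega) h
    have h2 := sigmaTwo_land_succ (u - 1)
    rw [Nat.sub_add_cancel hu] at h2
    rw [zero_mul, zero_add, Nat.zero_and, sigmaTwo_zero, zero_add, mul_comm q] at h1
    rw [h1, h2]
  · have h1 := sigmaTwo_land a 0 (q + 1) (2 ^ a - 1) 0 (by omega) (by omega)
    rw [zero_mul, zero_add, Nat.zero_and, Nat.and_zero, sigmaTwo_zero, zero_add,
      show (q + 1) * 2 ^ a + 0 = 2 ^ a * q + 2 ^ a by ring] at h1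
    rw [h1, sigmaTwo_two_pow]

theorem shiftedAlmostMinZeroEstimate_eq {h k u c : ℕ} (hk : 1 ≤ k) (hkh : k ≤ 2 ^ h)
    (hu : 1 ≤ u) (huk : u ≤ 2 ^ padicValNat 2 k) (hc : 1 ≤ c) (hlt : u < k) :
    shiftedAlmostMinZeroEstimate (c * 2 ^ h + u) k
      = (padicValNat 2 k : ℤ) + sigmaTwo k - padicValNat 2 u - 2 := by
  have hdvd : 2 ^ padicValNat 2 k ∣ k := pow_padicValNat_dvd
  have hah : padicValNat 2 k ≤ h :=
    (Nat.pow_le_pow_iff_right (by norm_num)).1 ((Nat.le_of_dvd hk hdvd).trans hkh)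
  unfold shiftedAlmostMinZeroEstimate
  obtain ⟨c, rfl⟩ : ∃ c', c = c' + 1 := ⟨c - 1, by omega⟩
  have e1 : (c + 1) * 2 ^ h + u - 1 = (c + 1) * 2 ^ h + (u - 1) := by omega
  -- One block `2 ^ h` is borrowed, so the upper digits of `n - 1` and `n - k` are consecutive
  -- numbers, while the lower ones are `u - 1` and `u` plus a multiple of `2 ^ ν(k)`.
  have e2 : (c + 1) * 2 ^ h + u - k = c * 2 ^ h + (2 ^ h - k + u) := by
    rw [add_mul, one_mul]; omega
  rw [card_twoPowers_inter, e1, e2, sigmaTwo_land _ _ _ _ _ (by omega) (by omega),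
    sigmaTwo_pow_mul_add _ _ _ (by omega)]
  have h1 := sigmaTwo_land_succ c
  rw [Nat.land_comm] at h1
  have h2 := sigmaTwo_land_of_dvd hu huk (Nat.dvd_sub (pow_dvd_pow 2 hah) hdvd)
  have h3 := sigmaTwo_succ_add_padicValNat (k - 1)
  have h4 := sigmaTwo_succ_add_padicValNat (u - 1)
  rw [Nat.sub_add_cancel hk] at h3
  rw [Nat.sub_add_cancel hu] at h4
  omega

/-! ### Parity of Stirling numbers -/

theorem stirlingSecond_add_two_modEq (n j : ℕ) :
    Nat.stirlingSecond (n + 2) (2 * j + 2)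
      ≡ Nat.stirlingSecond (n + 1) (2 * j + 2) + Nat.stirlingSecond n (2 * j) [MOD 2] := by
  rw [Nat.stirlingSecond_succ_succ (n + 1) (2 * j + 1), Nat.stirlingSecond_succ_succ n (2 * j),
    Nat.stirlingSecond_succ_succ n (2 * j + 1)]
  refine (Nat.modEq_iff_dvd).2 ⟨(j + 1) * Nat.stirlingSecond n (2 * j + 1 + 1)
    - (j + 1) * (2 * (j + 1) * Nat.stirlingSecond n (2 * j + 1 + 1)
      + Nat.stirlingSecond n (2 * j + 1)) - j * Nat.stirlingSecond n (2 * j + 1), ?_⟩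
  push_cast
  ring

/-- Modulo 2, two steps of the Stirling recursion give Pascal's rule. -/
theorem stirlingSecond_modEq_choose (j t : ℕ) :
    Nat.stirlingSecond (2 * j + 2 + t) (2 * j + 2) ≡ (j + t).choose j [MOD 2] := by
  induction j generalizing t with
  | zero =>
    induction t with
    | zero => rfl
    | succ t ih =>
      have h := stirlingSecond_add_two_modEq (t + 1) 0
      rw [Nat.mul_zero, Nat.stirlingSecond_succ_zero, add_zero] at h
      rw [show 2 * 0 + 2 + (t + 1) = t + 1 + 2 by ring]
      rw [show 2 * 0 + 2 + t = t + 1 + 1 by ring] at ih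
      simpa using h.trans ih
  | succ j ihj =>
    induction t with
    | zero =>
      rw [add_zero, add_zero, Nat.stirlingSecond_self, Nat.choose_self]
    | succ t iht =>
      have h := stirlingSecond_add_two_modEq (2 * (j + 1) + t + 1) (j + 1)
      have h2 := ihj (t + 1)
      rw [show 2 * (j + 1) + t + 1 + 1 = 2 * (j + 1) + 2 + t by ring] at h
      rw [show 2 * j + 2 + (t + 1) = 2 * (j + 1) + t + 1 by ring,
        show 2 * j + 2 = 2 * (j + 1) by ring] at h2
      rw [show 2 * (j + 1) + 2 + (t + 1) = 2 * (j + 1) + t + 1 + 2 by ring]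
      refine h.trans ((iht.add h2).trans ?_)
      rw [show j + 1 + (t + 1) = j + 1 + t + 1 by ring, Nat.choose_succ_succ,
        show j + (t + 1) = j + 1 + t by ring, add_comm]

theorem odd_choose_two_pow_sub_one (b M : ℕ) :
    Odd ((2 ^ b - 1 + M * 2 ^ b).choose (2 ^ b - 1)) := by
  have hb : 1 ≤ 2 ^ b := Nat.one_le_two_pow
  have h1 := padicValNat_choose_add_sigmaTwo (Nat.le_add_right (2 ^ b - 1) (M * 2 ^ b))
  have h2 := sigmaTwo_pow_mul_add b M (2 ^ b - 1) (by omega)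
  have h3 := sigmaTwo_pow_mul_add b M 0 (by omega)
  rw [Nat.add_sub_cancel_left] at h1
  rw [add_comm] at h2
  rw [add_zero, sigmaTwo_zero, add_zero] at h3
  rw [← Nat.not_even_iff_odd, even_iff_two_dvd]
  intro hd
  have := one_le_padicValNat_of_dvd (Nat.choose_pos (Nat.le_add_right _ _)).ne' hd
  omega

theorem odd_stirlingSecond_two_pow {a h : ℕ} (hah : a ≤ h) (c : ℕ) :
    Odd (Nat.stirlingSecond (c * 2 ^ h + 2 ^ a) (2 ^ a)) := by
  rcases a with _ | b
  · rw [pow_zero, Nat.stirlingSecond_one_right]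
    exact odd_one
  · have hb : 1 ≤ 2 ^ b := Nat.one_le_two_pow
    obtain ⟨s, rfl⟩ := Nat.exists_eq_add_of_le hah
    have h1 := stirlingSecond_modEq_choose (2 ^ b - 1) (c * 2 ^ (s + 1) * 2 ^ b)
    have h2 := odd_choose_two_pow_sub_one b (c * 2 ^ (s + 1))
    rw [show 2 * (2 ^ b - 1) + 2 = 2 ^ (b + 1) by rw [pow_succ]; omega,
      show 2 ^ (b + 1) + c * 2 ^ (s + 1) * 2 ^ b = c * 2 ^ (b + 1 + s) + 2 ^ (b + 1) by ring] at h1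
    rw [Nat.odd_iff] at h2 ⊢
    exact Eq.trans h1 h2

/-! ### The valuation of the Stirling numbers -/

theorem stirlingSecond_valuation {h k u c : ℕ} (hk : 1 ≤ k) (hkh : k ≤ 2 ^ h)
    (hu : 1 ≤ u) (huk : u ≤ 2 ^ padicValNat 2 k) (hc : 1 ≤ c) (hlt : u < k) :
    (IsMinimalExponent (padicValNat 2 k) u →
      ExactTwoPow ((padicValNat 2 k : ℤ) + sigmaTwo k - padicValNat 2 u - 2)
        (Nat.stirlingSecond (c * 2 ^ h + u) k : ℚ)) ∧
    (¬ IsMinimalExponent (padicValNat 2 k) u →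
      DvdTwoPow ((padicValNat 2 k : ℤ) + sigmaTwo k - padicValNat 2 u - 1)
        (Nat.stirlingSecond (c * 2 ^ h + u) k : ℚ)) := by
  have hmain := dvdTwoPow_factorial_mul_stirlingSecond_add hk hkh hu huk hlt hc
  have hE := binomialMoment_valuation (show k ≠ 0 by omega) rfl u hu huk
  set a := padicValNat 2 k
  set Q : ℚ := ((k.factorial * Nat.stirlingSecond (c * 2 ^ h + u) k : ℕ) : ℚ) with hQ
  have hsign : ((-1 : ℚ) ^ k) * (-1) ^ k = 1 := by rw [← mul_pow]; simp
  have hsgn : ExactTwoPow 0 ((-1 : ℚ) ^ k) := by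
    exact_mod_cast ExactTwoPow.intCast_of_odd (x := (-1) ^ k) (odd_neg.2 odd_one).pow
  have hP : (∑ j ∈ range (k + 1), (k.choose j : ℚ) * (j : ℚ) ^ u) / 2
      = 2 ^ k * 2⁻¹ * binomialMoment k u := by
    unfold binomialMoment
    field_simp
  rw [hP] at hmain
  -- Main term from the moment plus the error bounded by `hmain`, divided by `k!`, whose valuation
  -- is `k - σ(k)`.
  have hS : (Nat.stirlingSecond (c * 2 ^ h + u) k : ℚ)
      = (-1) ^ k * (-(2 ^ k * 2⁻¹ * binomialMoment k u)
        + ((-1) ^ k * Q + 2 ^ k * 2⁻¹ * binomialMoment k u)) * (k.factorial : ℚ)⁻¹ := by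
    have hne : (k.factorial : ℚ) ≠ 0 := by positivity
    rw [neg_add_cancel_comm_assoc, ← mul_assoc, hsign, one_mul, hQ]
    push_cast
    field_simp
  have hpow := (ExactTwoPow.pow k).mul ExactTwoPow.two.inv
  have hfac := (exactTwoPow_factorial k).inv
  rw [hS]
  constructor
  · intro hc
    have h1 := (hpow.mul (hE.1 hc)).neg.add (hmain.mono (by omega))
    convert (hsgn.mul h1).mul hfac using 1
    ring
  · intro hc
    have h1 := ((hpow.dvdTwoPow.mul (hE.2 hc)).neg).add (hmain.mono (by omega))
    convert (hsgn.dvdTwoPow.mul h1).mul hfac.dvdTwoPow using 1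
    ring

/-- For `a = 0` the number `2 ^ (a - 1)` is one half, hence the rational form here and the doubled
one in `IsMinimalExponent`. -/
theorem isMinimalExponent_iff (a u : ℕ) :
    IsMinimalExponent a u ↔ u = 1 ∨ (Even u ∧ (u : ℚ) ≤ 2 ^ ((a : ℤ) - 1)) ∨
      (u : ℚ) = 1 + 2 ^ ((a : ℤ) - 1) ∨ u = 2 ^ a := by
  have h : (2 : ℚ) ^ ((a : ℤ) - 1) = ((2 ^ a : ℕ) : ℚ) / 2 := by
    rw [zpow_sub_one₀ (by norm_num), zpow_natCast]
    push_cast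
    ring
  have h1 : (u : ℚ) ≤ 2 ^ ((a : ℤ) - 1) ↔ 2 * u ≤ 2 ^ a := by
    rw [h, le_div_iff₀ (by norm_num), mul_comm]
    exact_mod_cast Iff.rfl
  have h2 : (u : ℚ) = 1 + 2 ^ ((a : ℤ) - 1) ↔ 2 * u = 2 + 2 ^ a := by
    have h3 : (u : ℚ) = 1 + ((2 ^ a : ℕ) : ℚ) / 2 ↔ 2 * (u : ℚ) = 2 + ((2 ^ a : ℕ) : ℚ) := by
      constructor <;> intro h <;> linarith
    rw [h, h3]
    exact_mod_cast Iff.rfl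
  unfold IsMinimalExponent
  rw [h1, h2]

theorem theorem2p5 (h k u c : ℕ) (hk : 1 ≤ k) (hkh : k ≤ 2 ^ h)
    (hu : 1 ≤ u) (huk : u ≤ 2 ^ padicValNat 2 k) :
    (1 ≤ c → u < k →
      shiftedAlmostMinZeroEstimate (c * 2 ^ h + u) k
          = (padicValNat 2 k : ℤ) + sigmaTwo k - padicValNat 2 u - 2 ∧
      Nat.stirlingSecond (c * 2 ^ h + u) k ≠ 0 ∧
      (padicValNat 2 (Nat.stirlingSecond (c * 2 ^ h + u) k) : ℤ)
          ≥ (padicValNat 2 k : ℤ) + sigmaTwo k - padicValNat 2 u - 2 ∧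
      ((padicValNat 2 (Nat.stirlingSecond (c * 2 ^ h + u) k) : ℤ)
          = (padicValNat 2 k : ℤ) + sigmaTwo k - padicValNat 2 u - 2 ↔
        u = 1 ∨
        (Even u ∧ (u : ℚ) ≤ 2 ^ ((padicValNat 2 k : ℤ) - 1)) ∨
        (u : ℚ) = 1 + 2 ^ ((padicValNat 2 k : ℤ) - 1) ∨
        u = 2 ^ padicValNat 2 k)) ∧
    (u = k →
      sigmaTwo k = 1 ∧ Odd (Nat.stirlingSecond (c * 2 ^ h + u) k)) := by
  have hdvd : 2 ^ padicValNat 2 k ∣ k := pow_padicValNat_dvd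
  have hle := Nat.le_of_dvd hk hdvd
  refine ⟨fun hc hlt => ?_, ?_⟩
  · have hch : 2 ^ h ≤ c * 2 ^ h := Nat.le_mul_of_pos_left _ hc
    have hne : Nat.stirlingSecond (c * 2 ^ h + u) k ≠ 0 :=
      (stirlingSecond_pos hk (by omega)).ne'
    have hval := stirlingSecond_valuation hk hkh hu huk hc hlt
    refine ⟨shiftedAlmostMinZeroEstimate_eq hk hkh hu huk hc hlt, hne, ?_⟩
    rw [← isMinimalExponent_iff]
    by_cases hmin : IsMinimalExponent (padicValNat 2 k) u
    · have h1 := (hval.1 hmin).padicValNat_eq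
      exact ⟨h1.ge, fun _ => hmin, fun _ => h1⟩
    · have h1 := (hval.2 hmin).le_padicValNat hne
      exact ⟨by omega, fun h2 => by omega, fun h2 => absurd h2 hmin⟩
  · rintro rfl
    have hpow : u = 2 ^ padicValNat 2 u := le_antisymm huk hle
    have hah : padicValNat 2 u ≤ h :=
      (Nat.pow_le_pow_iff_right (by norm_num)).1 (hle.trans hkh)
    have h1 := odd_stirlingSecond_two_pow hah c
    rw [← hpow] at h1
    refine ⟨?_, h1⟩
    rw [hpow]
    exact sigmaTwo_two_pow _
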